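/- Let $\mu$ denote Lebesgue measure on $\mathbb{R}$. A function $w\in L^2(\mathbb{R})$ (complex valued) is an orthonormal wavelet if the functions $w_{j,k}(s)=2^{j/2}w(2^js-k)$, $j,k\in\mathbb{Z}$, form an orthonormal basis of $L^2(\mathbb{R})$. A Lebesgue measurable set $W\subseteq\mathbb{R}$ is a wavelet set if $\mu(W)^{-1/2}\chi_W=\widehat{w}$ almost everywhere for some orthonormal wavelet $w$, where $\widehat{\ }$ is the Fourier–Plancherel transform on $L^2(\mathbb{R})$, given on $L^1(\mathbb{R})\cap L^2(\mathbb{R})$ by $\widehat{f}(x)=\frac{1}{\sqrt{2\pi}}\int_{\mathbb{R}}e^{-itx}f(t)\,d\mu(t)$. For wavelet sets $W,W'$ put $$d(W,W')=\mu(W\nabla W')^{1/2}+\Big(\int_{W\nabla W'}\frac{1}{|x|}\,d\mu(x)\Big)^{1/2},\qquad W\nabla W'=(W\setminus W')\cup(W'\setminus W).$$ Theorem. For any two wavelet sets $W_0$ and $W_1$ there is a family $\{W_t\}_{t\in[0,1]}$ of wavelet sets, whose members at $t=0$ and $t=1$ are the given sets $W_0$ and $W_1$, such that for every $s\in[0,1]$,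 $d(W_t,W_s)\to 0$ as $t\to s$ in $[0,1]$. -/

import Mathlib

open MeasureTheory Filter Topology
open scoped ENNReal FourierTransform

noncomputable section

/-- `w ∈ L²(ℝ)` is an orthonormal wavelet: the functions `s ↦ 2^{j/2} w(2^j s - k)`, `j, k ∈ ℤ`,
form an orthonormal (Hilbert) basis of `L²(ℝ)`. -/
def IsOrthonormalWavelet (w : Lp ℂ 2 (volume : Measure ℝ)) : Prop :=
  ∃ b : HilbertBasis (ℤ × ℤ) ℂ (Lp ℂ 2 (volume : Measure ℝ)),
    ∀ j k : ℤ, (b (j, k) : ℝ → ℂ) =ᵐ[volume]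
      fun s : ℝ ↦ (((2 : ℝ) ^ ((j : ℝ) / 2) : ℝ) : ℂ) * w ((2 : ℝ) ^ j * s - (k : ℝ))

/-- The Fourier-Plancherel transform on `L²(ℝ)` in the unitary angular-frequency normalization
`f̂(x) = (2π)^{-1/2} ∫ e^{-itx} f(t) dt` (a function defined up to null sets). Mathlib's
Plancherel transform `𝓕` has the kernel `e^{-2πitx}`, hence the rescaling. -/
def fourierPlancherel (f : Lp ℂ 2 (volume : Measure ℝ)) : ℝ → ℂ :=
  fun x ↦ (((√(2 * Real.pi))⁻¹ : ℝ) : ℂ) *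
    ((𝓕 f : Lp ℂ 2 (volume : Measure ℝ)) : ℝ → ℂ) (x / (2 * Real.pi))

/-- A (Lebesgue) measurable set `W ⊆ ℝ` is a wavelet set if `μ(W)^{-1/2} χ_W` is the
Fourier-Plancherel transform of an orthonormal wavelet. If `μ(W)` is `0` or `∞`, the function
below is `0`, which is not the transform of a wavelet, so such sets are not wavelet sets. -/
def IsWaveletSet (W : Set ℝ) : Prop :=
  NullMeasurableSet W (volume : Measure ℝ) ∧
    ∃ w : Lp ℂ 2 (volume : Measure ℝ), IsOrthonormalWavelet w ∧
      fourierPlancherel w =ᵐ[volume]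
        W.indicator fun _ ↦ (((√((volume : Measure ℝ).real W))⁻¹ : ℝ) : ℂ)

/-- `d(W, W') = μ(W ∇ W')^{1/2} + (∫_{W ∇ W'} dx / |x|)^{1/2}`, computed in `[0, ∞]`. -/
def waveletSetDist (W W' : Set ℝ) : ℝ≥0∞ :=
  (volume (symmDiff W W')) ^ (1 / 2 : ℝ) +
    (∫⁻ x in symmDiff W W', ENNReal.ofReal (1 / |x|)) ^ (1 / 2 : ℝ)

end

/-! A set is a wavelet set exactly when, up to null sets, it tiles the line both by translations by
multiples of 2π and by dilations by powers of 2 (`isWaveletSet_iff`). The theorem thus becomes one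
about common sections of two equivalence relations, and any period p > 0 will do.

Every tiling set W is joined to one fixed set. Up to a null set, W is a set A₀ whose points are
pairwise inequivalent for both relations. If 2ε ≤ p ≤ R, the interval [R, R + p) is a full section
for translations and a partial one for dilations, while the annulus ε/2 ≤ |x| ≤ ε (with suitable
endpoints) is a partial section for translations and a full one for dilations away from 0. Delete
from A₀ the translation classes of [-ε, ε) and the dilation classes of [R, R + p); a
Cantor–Bernstein matching between annulus and interval then completes what is left to a common
section. For ε = p/2 nothing of A₀ survives, so the result no longer depends on W.

As ε → 0 and R → ∞ the deleted part becomes small for both dx and dx/|x|. Two tilings have the same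
measure, so the added part is equally small (`measure_symmDiff_le_of_measure_eq`), and the path
converges to W.

At positive parameters, continuity follows by dominated convergence once almost every point has
eventually constant membership. The delicate piece is the infinite Cantor–Bernstein chain. An
unstable point must be linked by one chain step to another unstable point; a step moves points of
size at least R to points of size at most ε and back by a translation, so it shrinks Lebesgue
measure by the factor ε/R ≤ 1/2. The unstable set is therefore null
(`volume_eq_zero_of_subset_chainStep`, `EventuallyStable.chainSet`). -/

noncomputable section

namespace WaveletSet

/-! ### A Cantor–Bernstein construction for two equivalence relations -/

section CantorBernstein

variable {α : Type*} (r s : Setoid α) (A I K : Set α)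

/-- The saturation of a set under an equivalence relation. -/
def sat (r : Setoid α) (S : Set α) : Set α := {x | ∃ y ∈ S, r x y}

/-- No two distinct points of `S` are equivalent. -/
def IsPartialSection (r : Setoid α) (S : Set α) : Prop := ∀ x ∈ S, ∀ y ∈ S, r x y → x = y

/-- The points of `K` that are matched in `K` because no point of `I` is available for them. -/
def chainStart : Set α := (K \ sat r A) \ sat r (I \ sat s A)

/-- The points of `K` that are equivalent to a point of `I` displaced by `Q`. -/
def chainStep (Q : Set α) : Set α := K ∩ sat r (I ∩ sat s Q)

/-- The points of `K` used in the Cantor–Bernstein matching. -/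
def chainSet : Set α := ⋃ n : ℕ, (chainStep r s I K)^[n] (chainStart r s A I K)

/-- The common section of `r` and `s` containing `A` obtained from the Cantor–Bernstein matching
between a section `K` of `r` and a section `I` of `s`. -/
def commonSection : Set α :=
  A ∪ chainSet r s A I K ∪ ((I \ sat s A) \ sat s (chainSet r s A I K))

variable {r s A I K}

theorem chainStep_iUnion {ι : Type*} (Q : ι → Set α) :
    chainStep r s I K (⋃ i, Q i) = ⋃ i, chainStep r s I K (Q i) := by
  ext x
  simp only [chainStep, sat, Set.mem_inter_iff, Set.mem_iUnion, Set.mem_ofPred_eq]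
  grind

/-- The step commutes with unions, so the union of its iterates is a fixed point of Q ↦ start ∪ step
Q. This recursion, rather than the iterates, drives the section and stability arguments. -/
theorem chainSet_eq :
    chainSet r s A I K = chainStart r s A I K ∪ chainStep r s I K (chainSet r s A I K) := by
  conv_rhs => rw [chainSet, chainStep_iUnion]
  simp_rw [← Function.iterate_succ_apply']
  rw [chainSet]
  ext x
  simp only [Set.mem_iUnion, Set.mem_union]
  constructor
  · rintro ⟨n, hn⟩
    cases n with
    | zero => exact Or.inl hn
    | succ n => exact Or.inr ⟨n, hn⟩
  · rintro (h | ⟨n, hn⟩)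
    · exact ⟨0, h⟩
    · exact ⟨n + 1, hn⟩

theorem mem_chainSet_iff {y : α} :
    y ∈ chainSet r s A I K ↔ y ∈ chainStart r s A I K ∨
      y ∈ K ∧ ∃ x ∈ I, r y x ∧ ∃ z ∈ chainSet r s A I K, s x z := by
  conv_lhs => rw [chainSet_eq]
  simp only [chainStep, sat, Set.mem_union, Set.mem_inter_iff, Set.mem_ofPred_eq]
  grind

theorem chainSet_subset : chainSet r s A I K ⊆ K := by
  intro y hy
  rcases mem_chainSet_iff.1 hy with h | h
  · exact h.1.1
  · exact h.1

theorem chainSet_disjoint_sat (hAI : Disjoint I (sat r A)) :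
    Disjoint (chainSet r s A I K) (sat r A) := by
  rw [Set.disjoint_left] at hAI ⊢
  rintro y hy ⟨a, ha, hya⟩
  rcases mem_chainSet_iff.1 hy with h | ⟨-, x, hx, hyx, -⟩
  · exact h.1.2 ⟨a, ha, hya⟩
  · exact hAI hx ⟨a, ha, r.trans (r.symm hyx) hya⟩

theorem commonSection_subset : commonSection r s A I K ⊆ A ∪ K ∪ I := by
  rintro x ((h | h) | h)
  · exact Or.inl (Or.inl h)
  · exact Or.inl (Or.inr (chainSet_subset h))
  · exact Or.inr h.1.1

theorem subset_commonSection : A ⊆ commonSection r s A I K :=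
  fun _ h ↦ Or.inl (Or.inl h)

theorem isPartialSection_union₃ {B C : Set α} (hA : IsPartialSection r A)
    (hB : IsPartialSection r B) (hC : IsPartialSection r C) (hAB : Disjoint B (sat r A))
    (hAC : Disjoint C (sat r A)) (hBC : Disjoint C (sat r B)) :
    IsPartialSection r (A ∪ B ∪ C) := by
  rw [Set.disjoint_left] at *
  rintro x ((hx | hx) | hx) y ((hy | hy) | hy) hxy
  · exact hA x hx y hy hxy
  · exact (hAB hy ⟨x, hx, r.symm hxy⟩).elim
  · exact (hAC hy ⟨x, hx, r.symm hxy⟩).elim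
  · exact (hAB hx ⟨y, hy, hxy⟩).elim
  · exact hB x hx y hy hxy
  · exact (hBC hy ⟨x, hx, r.symm hxy⟩).elim
  · exact (hAC hx ⟨y, hy, hxy⟩).elim
  · exact (hBC hx ⟨y, hy, hxy⟩).elim
  · exact hC x hx y hy hxy

theorem IsPartialSection.mono {S T : Set α} (hT : IsPartialSection r T) (h : S ⊆ T) :
    IsPartialSection r S := fun x hx y hy ↦ hT x (h hx) y (h hy)

/-- The only real conflict is between a chain point y and a retained point x of I. If y is a start
point, no such x is available. Otherwise y is linked to a displaced point of I, which must be x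
because I is a partial section of r, and displaced points are not retained. -/
theorem isPartialSection_commonSection_left (hA : IsPartialSection r A)
    (hI : IsPartialSection r I) (hK : IsPartialSection r K) (hAI : Disjoint I (sat r A)) :
    IsPartialSection r (commonSection r s A I K) := by
  refine isPartialSection_union₃ hA (hK.mono chainSet_subset)
    (hI.mono fun x hx ↦ hx.1.1) (chainSet_disjoint_sat hAI)
    (hAI.mono_left fun x hx ↦ hx.1.1) ?_
  rw [Set.disjoint_left]
  rintro x ⟨⟨hxI, hxA⟩, hxY⟩ ⟨y, hy, hxy⟩
  rcases mem_chainSet_iff.1 hy with h | ⟨-, x', hx', hyx, z, hz, hxz⟩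
  · exact h.2 ⟨x, ⟨hxI, hxA⟩, r.symm hxy⟩
  · obtain rfl := hI x hxI x' hx' (r.trans hxy hyx)
    exact hxY ⟨z, hz, hxz⟩

/-- For s the retained part of I avoids the classes of A and of the chain by construction. -/
theorem isPartialSection_commonSection_right (hA : IsPartialSection s A)
    (hI : IsPartialSection s I) (hK : IsPartialSection s K) (hAK : Disjoint K (sat s A)) :
    IsPartialSection s (commonSection r s A I K) := by
  refine isPartialSection_union₃ hA (hK.mono chainSet_subset)
    (hI.mono fun x hx ↦ hx.1.1) (hAK.mono_left chainSet_subset) ?_ ?_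
  · rw [Set.disjoint_left]
    exact fun x hx ↦ hx.1.2
  · rw [Set.disjoint_left]
    exact fun x hx ↦ hx.2

/-- A point of K outside the chain and not covered by A fails to be a start point, so it has an
r-partner in I. That partner is not displaced, since otherwise the point would enter the chain by a
step. -/
theorem mem_sat_commonSection_left {x : α} (hx : x ∈ sat r K) :
    x ∈ sat r (commonSection r s A I K) := by
  obtain ⟨y, hy, hxy⟩ := hx
  by_cases hA : y ∈ sat r A
  · obtain ⟨a, ha, hya⟩ := hA
    exact ⟨a, subset_commonSection ha, r.trans hxy hya⟩
  by_cases hY : y ∈ chainSet r s A I K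
  · exact ⟨y, Or.inl (Or.inr hY), hxy⟩
  have h0 : y ∈ sat r (I \ sat s A) := by
    by_contra h
    exact hY (mem_chainSet_iff.2 (Or.inl ⟨⟨hy, hA⟩, h⟩))
  obtain ⟨x', hx', hyx⟩ := h0
  refine ⟨x', Or.inr ⟨hx', ?_⟩, r.trans hxy hyx⟩
  rintro ⟨z, hz, hxz⟩
  exact hY (mem_chainSet_iff.2 (Or.inr ⟨hy, x', hx'.1, hyx, z, hz, hxz⟩))

theorem mem_sat_commonSection_right {x : α} (hx : x ∈ sat s I) :
    x ∈ sat s (commonSection r s A I K) := by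
  obtain ⟨y, hy, hxy⟩ := hx
  by_cases hA : y ∈ sat s A
  · obtain ⟨a, ha, hya⟩ := hA
    exact ⟨a, subset_commonSection ha, s.trans hxy hya⟩
  by_cases hY : y ∈ sat s (chainSet r s A I K)
  · obtain ⟨a, ha, hya⟩ := hY
    exact ⟨a, Or.inl (Or.inr ha), s.trans hxy hya⟩
  · exact ⟨y, Or.inr ⟨⟨hy, hA⟩, hY⟩, hxy⟩

end CantorBernstein

/-! ### Translations and dilations of the line -/

/-- Two reals are equivalent if they differ by an integer multiple of `p`. -/
def translationSetoid (p : ℝ) : Setoid ℝ where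
  r x y := ∃ k : ℤ, x + k * p = y
  iseqv :=
    { refl := fun x ↦ ⟨0, by simp⟩
      symm := by
        rintro x y ⟨k, rfl⟩
        exact ⟨-k, by push_cast; ring⟩
      trans := by
        rintro x y z ⟨k, rfl⟩ ⟨l, rfl⟩
        exact ⟨k + l, by push_cast; ring⟩ }

/-- Two reals are equivalent if they differ by a factor that is an integer power of `2`. -/
def dilationSetoid : Setoid ℝ where
  r x y := ∃ j : ℤ, (2 : ℝ) ^ j * x = y
  iseqv :=
    { refl := fun x ↦ ⟨0, by simp⟩
      symm := by
        rintro x y ⟨k, rfl⟩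
        exact ⟨-k, by rw [← mul_assoc, ← zpow_add₀ two_ne_zero]; simp⟩
      trans := by
        rintro x y z ⟨k, rfl⟩ ⟨l, rfl⟩
        exact ⟨l + k, by rw [← mul_assoc, ← zpow_add₀ two_ne_zero]⟩ }

theorem mem_sat_translation {p x : ℝ} {S : Set ℝ} :
    x ∈ sat (translationSetoid p) S ↔ ∃ k : ℤ, x + k * p ∈ S := by
  constructor
  · rintro ⟨_, hy, k, rfl⟩
    exact ⟨k, hy⟩
  · rintro ⟨k, hk⟩
    exact ⟨_, hk, k, rfl⟩

theorem mem_sat_dilation {x : ℝ} {S : Set ℝ} :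
    x ∈ sat dilationSetoid S ↔ ∃ j : ℤ, (2 : ℝ) ^ j * x ∈ S := by
  constructor
  · rintro ⟨_, hy, k, rfl⟩
    exact ⟨k, hy⟩
  · rintro ⟨k, hk⟩
    exact ⟨_, hk, k, rfl⟩

theorem measurableSet_sat_translation (p : ℝ) {S : Set ℝ} (hS : MeasurableSet S) :
    MeasurableSet (sat (translationSetoid p) S) := by
  have : sat (translationSetoid p) S = ⋃ k : ℤ, (fun x ↦ x + k * p) ⁻¹' S := by
    ext x; simp [mem_sat_translation]
  rw [this]
  exact MeasurableSet.iUnion fun k ↦ (measurable_add_const _) hS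

theorem measurableSet_sat_dilation {S : Set ℝ} (hS : MeasurableSet S) :
    MeasurableSet (sat dilationSetoid S) := by
  have : sat dilationSetoid S = ⋃ j : ℤ, (fun x ↦ (2 : ℝ) ^ j * x) ⁻¹' S := by
    ext x; simp [mem_sat_dilation]
  rw [this]
  exact MeasurableSet.iUnion fun k ↦ (measurable_const_mul _) hS

theorem measurableSet_chainStep (p : ℝ) {I K Q : Set ℝ} (hI : MeasurableSet I)
    (hK : MeasurableSet K) (hQ : MeasurableSet Q) :
    MeasurableSet (chainStep (translationSetoid p) dilationSetoid I K Q) :=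
  hK.inter (measurableSet_sat_translation p (hI.inter (measurableSet_sat_dilation hQ)))

theorem measurableSet_chainSet (p : ℝ) {A I K : Set ℝ} (hA : MeasurableSet A)
    (hI : MeasurableSet I) (hK : MeasurableSet K) :
    MeasurableSet (chainSet (translationSetoid p) dilationSetoid A I K) := by
  refine MeasurableSet.iUnion fun n ↦ ?_
  induction n with
  | zero =>
    exact (hK.diff (measurableSet_sat_translation p hA)).diff
      (measurableSet_sat_translation p (hI.diff (measurableSet_sat_dilation hA)))
  | succ n ih =>
    rw [Function.iterate_succ_apply']
    exact measurableSet_chainStep p hI hK ih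

theorem measurableSet_commonSection (p : ℝ) {A I K : Set ℝ} (hA : MeasurableSet A)
    (hI : MeasurableSet I) (hK : MeasurableSet K) :
    MeasurableSet (commonSection (translationSetoid p) dilationSetoid A I K) := by
  have hY := measurableSet_chainSet p hA hI hK
  exact (hA.union hY).union
    ((hI.diff (measurableSet_sat_dilation hA)).diff (measurableSet_sat_dilation hY))

/-! ### Tilings -/

/-- Almost every point has exactly one translate by a multiple of `p` in `W`. -/
def TilesByTranslation (p : ℝ) (W : Set ℝ) : Prop := ∀ᵐ x : ℝ, ∃! k : ℤ, x + k * p ∈ W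

/-- Almost every point has exactly one dilate by a power of `2` in `W`. -/
def TilesByDilation (W : Set ℝ) : Prop := ∀ᵐ x : ℝ, ∃! j : ℤ, (2 : ℝ) ^ j * x ∈ W

theorem IsPartialSection.translation_unique {p : ℝ} (hp : p ≠ 0) {S : Set ℝ}
    (hS : IsPartialSection (translationSetoid p) S) {x : ℝ} {k l : ℤ} (hk : x + k * p ∈ S)
    (hl : x + l * p ∈ S) : k = l := by
  have := hS _ hk _ hl ⟨l - k, by push_cast; ring⟩
  have h : (k : ℝ) = l := mul_right_cancel₀ hp (add_left_cancel this)
  exact_mod_cast h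

theorem IsPartialSection.dilation_unique {S : Set ℝ}
    (hS : IsPartialSection dilationSetoid S) {x : ℝ} (hx : x ≠ 0) {k l : ℤ}
    (hk : (2 : ℝ) ^ k * x ∈ S) (hl : (2 : ℝ) ^ l * x ∈ S) : k = l := by
  have := hS _ hk _ hl ⟨l - k, by rw [← mul_assoc, ← zpow_add₀ two_ne_zero]; simp⟩
  exact zpow_right_injective₀ (by norm_num) (by norm_num) (mul_right_cancel₀ hx this)

theorem ae_ne (a : ℝ) : ∀ᵐ x : ℝ, x ≠ a := by
  simp [ae_iff, measure_singleton]

theorem tilesByTranslation_of_section {p : ℝ} (hp : p ≠ 0) {S : Set ℝ}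
    (hS : IsPartialSection (translationSetoid p) S)
    (hcov : ∀ x, x ∈ sat (translationSetoid p) S) : TilesByTranslation p S := by
  refine Eventually.of_forall fun x ↦ ?_
  obtain ⟨k, hk⟩ := mem_sat_translation.1 (hcov x)
  exact ⟨k, hk, fun l hl ↦ hS.translation_unique hp hl hk⟩

theorem tilesByDilation_of_section {S : Set ℝ} (hS : IsPartialSection dilationSetoid S)
    (hcov : ∀ x ≠ 0, x ∈ sat dilationSetoid S) : TilesByDilation S := by
  filter_upwards [ae_ne 0] with x hx
  obtain ⟨k, hk⟩ := mem_sat_dilation.1 (hcov x hx)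
  exact ⟨k, hk, fun l hl ↦ hS.dilation_unique hx hl hk⟩

/-- The dilation invariant measure `dx / |x|`. -/
def dilationMeasure : Measure ℝ := volume.withDensity fun x ↦ ENNReal.ofReal (1 / |x|)

theorem measurable_ofReal_one_div_abs : Measurable fun x : ℝ ↦ ENNReal.ofReal (1 / |x|) := by
  fun_prop

theorem dilationMeasure_ac : dilationMeasure ≪ volume := withDensity_absolutelyContinuous _ _

theorem measurePreserving_translation (p : ℝ) (k : ℤ) :
    MeasurePreserving (fun x : ℝ ↦ x + k * p) volume volume :=
  measurePreserving_add_right volume _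

theorem quasiMeasurePreserving_mul {c : ℝ} (hc : c ≠ 0) :
    Measure.QuasiMeasurePreserving (fun x : ℝ ↦ c * x) volume volume := by
  refine ⟨measurable_const_mul c, ?_⟩
  rw [Real.map_volume_mul_left hc]
  exact Measure.smul_absolutelyContinuous

theorem lintegral_comp_mul {c : ℝ} (hc : c ≠ 0) {f : ℝ → ℝ≥0∞} (hf : Measurable f) :
    ∫⁻ x, f (c * x) = ENNReal.ofReal |c⁻¹| * ∫⁻ x, f x := by
  rw [← lintegral_map hf (measurable_const_mul c), Real.map_volume_mul_left hc,
    lintegral_smul_measure, smul_eq_mul]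

/-- The density 1/|x| scales by the inverse of the dilation factor, which cancels the Jacobian. -/
theorem measurePreserving_dilation (j : ℤ) :
    MeasurePreserving (fun x : ℝ ↦ (2 : ℝ) ^ j * x) dilationMeasure dilationMeasure := by
  have hc : (2 : ℝ) ^ j ≠ 0 := zpow_ne_zero _ two_ne_zero
  have hc0 : 0 < (2 : ℝ) ^ j := zpow_pos two_pos _
  set c : ℝ := 2 ^ j
  refine ⟨measurable_const_mul c, ?_⟩
  ext S hS
  rw [Measure.map_apply (measurable_const_mul c) hS, dilationMeasure, withDensity_apply _ hS,
    withDensity_apply _ ((measurable_const_mul c) hS), ← lintegral_indicator hS,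
    ← lintegral_indicator ((measurable_const_mul c) hS)]
  have h1 := lintegral_comp_mul hc ((measurable_ofReal_one_div_abs.indicator hS))
  have h2 : ∀ x, ((fun x ↦ c * x) ⁻¹' S).indicator (fun x : ℝ ↦ ENNReal.ofReal (1 / |x|)) x =
      ENNReal.ofReal c * S.indicator (fun x : ℝ ↦ ENNReal.ofReal (1 / |x|)) (c * x) := by
    intro x
    by_cases hx : c * x ∈ S
    · rw [Set.indicator_of_mem (by exact hx), Set.indicator_of_mem hx,
        ← ENNReal.ofReal_mul hc0.le, abs_mul, abs_of_pos hc0]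
      congr 1
      field_simp
    · rw [Set.indicator_of_notMem (by exact hx), Set.indicator_of_notMem hx, mul_zero]
  simp_rw [h2]
  rw [lintegral_const_mul' _ _ ENNReal.ofReal_ne_top, h1, ← mul_assoc, ← ENNReal.ofReal_mul hc0.le,
    abs_of_pos (inv_pos.2 hc0), mul_inv_cancel₀ hc, ENNReal.ofReal_one, one_mul]

/-- A set whose points have pairwise inequivalent orbits, all of which meet `B`, has measure at
most that of `B`. -/
theorem measure_le_of_orbits_meet {m : Measure ℝ} {φ : ℤ → ℝ → ℝ}
    (hφ : ∀ i, MeasurePreserving (φ i) m m) (hinv : ∀ i x, φ (-i) (φ i x) = x) {A B : Set ℝ}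
    (hA : NullMeasurableSet A m) (hB : NullMeasurableSet B m)
    (hcov : ∀ᵐ x ∂m, x ∈ A → ∃ i, φ i x ∈ B)
    (hinj : ∀ᵐ x ∂m, ∀ i j, φ i x ∈ A → φ j x ∈ A → i = j) : m A ≤ m B := by
  have hmeas : ∀ i, NullMeasurableSet (φ (-i) ⁻¹' A ∩ B) m := fun i ↦
    (hA.preimage (hφ (-i)).quasiMeasurePreserving).inter hB
  -- Cut A according to the index that carries a point into B. Each piece has the measure of its
  -- image in B, and the images are almost disjoint because no orbit meets A twice.
  have hset : ∀ i, A ∩ φ i ⁻¹' B = φ i ⁻¹' (φ (-i) ⁻¹' A ∩ B) := by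
    intro i
    ext x
    simp [hinv]
  have h1 : m A ≤ m (⋃ i, A ∩ φ i ⁻¹' B) := by
    refine measure_mono_ae ?_
    filter_upwards [hcov] with x hx hxA
    obtain ⟨i, hi⟩ := hx hxA
    exact Set.mem_iUnion.2 ⟨i, hxA, hi⟩
  have hdisj : Pairwise (Function.onFun (AEDisjoint m) fun i ↦ φ (-i) ⁻¹' A ∩ B) := by
    intro i j hij
    refine measure_mono_null (t := {x | ¬ ∀ i j, φ i x ∈ A → φ j x ∈ A → i = j}) ?_ hinj
    rintro x ⟨⟨hi, -⟩, ⟨hj, -⟩⟩ h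
    exact hij (neg_injective (h _ _ hi hj))
  calc m A ≤ ∑' i, m (A ∩ φ i ⁻¹' B) := h1.trans (measure_iUnion_le _)
    _ = ∑' i, m (φ (-i) ⁻¹' A ∩ B) := by
      congr with i
      rw [hset, (hφ i).measure_preimage (hmeas i)]
    _ = m (⋃ i, φ (-i) ⁻¹' A ∩ B) := (measure_iUnion₀ hdisj hmeas).symm
    _ ≤ m B := measure_mono (Set.iUnion_subset fun i ↦ Set.inter_subset_right)

theorem volume_le_of_translates_meet {p : ℝ} {A B : Set ℝ} (hA : NullMeasurableSet A)
    (hB : NullMeasurableSet B) (hcov : ∀ᵐ x : ℝ, x ∈ A → ∃ k : ℤ, x + k * p ∈ B)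
    (hinj : ∀ᵐ x : ℝ, ∀ k l : ℤ, x + k * p ∈ A → x + l * p ∈ A → k = l) :
    volume A ≤ volume B :=
  measure_le_of_orbits_meet (φ := fun k x ↦ x + k * p) (measurePreserving_translation p)
    (fun i x ↦ by push_cast; ring) hA hB hcov hinj

theorem dilationMeasure_le_of_dilates_meet {A B : Set ℝ} (hA : NullMeasurableSet A)
    (hB : NullMeasurableSet B) (hcov : ∀ᵐ x : ℝ, x ∈ A → ∃ j : ℤ, (2 : ℝ) ^ j * x ∈ B)
    (hinj : ∀ᵐ x : ℝ, ∀ k l : ℤ, (2 : ℝ) ^ k * x ∈ A → (2 : ℝ) ^ l * x ∈ A → k = l) :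
    dilationMeasure A ≤ dilationMeasure B :=
  measure_le_of_orbits_meet (φ := fun j x ↦ (2 : ℝ) ^ j * x) measurePreserving_dilation
    (fun i x ↦ by rw [← mul_assoc, ← zpow_add₀ two_ne_zero]; simp)
    (hA.mono_ac dilationMeasure_ac) (hB.mono_ac dilationMeasure_ac)
    (dilationMeasure_ac.ae_le hcov) (dilationMeasure_ac.ae_le hinj)

theorem TilesByTranslation.volume_eq {p : ℝ} {W W' : Set ℝ} (hW : TilesByTranslation p W)
    (hW' : TilesByTranslation p W') (hm : NullMeasurableSet W) (hm' : NullMeasurableSet W') :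
    volume W = volume W' :=
  le_antisymm
    (volume_le_of_translates_meet hm hm' (hW'.mono fun _ h _ ↦ h.exists)
      (hW.mono fun _ h _ _ hk hl ↦ h.unique hk hl))
    (volume_le_of_translates_meet hm' hm (hW.mono fun _ h _ ↦ h.exists)
      (hW'.mono fun _ h _ _ hk hl ↦ h.unique hk hl))

theorem TilesByDilation.dilationMeasure_eq {W W' : Set ℝ} (hW : TilesByDilation W)
    (hW' : TilesByDilation W') (hm : NullMeasurableSet W) (hm' : NullMeasurableSet W') :
    dilationMeasure W = dilationMeasure W' :=
  le_antisymm
    (dilationMeasure_le_of_dilates_meet hm hm' (hW'.mono fun _ h _ ↦ h.exists)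
      (hW.mono fun _ h _ _ hk hl ↦ h.unique hk hl))
    (dilationMeasure_le_of_dilates_meet hm' hm (hW.mono fun _ h _ ↦ h.exists)
      (hW'.mono fun _ h _ _ hk hl ↦ h.unique hk hl))

/-! ### Comparison of Lebesgue measure and the dilation invariant measure -/

/-- Together with the reverse bound below, this is the source of the contraction factor ε/R:
dilations preserve dx/|x|, while Lebesgue measure is compared with it near 0 and far from 0. -/
theorem volume_le_mul_dilationMeasure {S : Set ℝ} (hS : MeasurableSet S) {C : ℝ} (hC : 0 < C)
    (h : ∀ x ∈ S, |x| ≤ C) : volume S ≤ ENNReal.ofReal C * dilationMeasure S := by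
  rw [dilationMeasure, withDensity_apply _ hS,
    ← lintegral_const_mul _ measurable_ofReal_one_div_abs, ← setLIntegral_one]
  refine lintegral_mono_ae ?_
  filter_upwards [ae_restrict_mem hS, ae_restrict_of_ae (ae_ne 0)] with x hx hx0
  have hx0' := abs_pos.2 hx0
  rw [← ENNReal.ofReal_mul hC.le, ← ENNReal.ofReal_one]
  refine ENNReal.ofReal_le_ofReal ?_
  rw [mul_one_div, le_div_iff₀ hx0', one_mul]
  exact h x hx

theorem dilationMeasure_le_mul_volume {S : Set ℝ} (hS : MeasurableSet S) {c : ℝ} (hc : 0 < c)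
    (h : ∀ x ∈ S, c ≤ |x|) : dilationMeasure S ≤ ENNReal.ofReal (1 / c) * volume S := by
  rw [dilationMeasure, withDensity_apply _ hS, ← setLIntegral_const]
  refine lintegral_mono_ae ?_
  filter_upwards [ae_restrict_mem hS] with x hx
  exact ENNReal.ofReal_le_ofReal (one_div_le_one_div_of_le hc (h x hx))

/-! ### Families of sets that are eventually constant at almost every point -/

section Stable

variable {ι : Type*} {l : Filter ι}

/-- Membership of almost every point in `S u` agrees with membership in `S₀` eventually. -/
def EventuallyStable (l : Filter ι) (S : ι → Set ℝ) (S₀ : Set ℝ) : Prop :=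
  ∀ᵐ x : ℝ, ∀ᶠ u in l, (x ∈ S u ↔ x ∈ S₀)

variable {S T : ι → Set ℝ} {S₀ T₀ : Set ℝ}

theorem EventuallyStable.const (S₀ : Set ℝ) : EventuallyStable l (fun _ ↦ S₀) S₀ :=
  Eventually.of_forall fun _ ↦ Eventually.of_forall fun _ ↦ Iff.rfl

theorem EventuallyStable.inter (hS : EventuallyStable l S S₀) (hT : EventuallyStable l T T₀) :
    EventuallyStable l (fun u ↦ S u ∩ T u) (S₀ ∩ T₀) := by
  filter_upwards [hS, hT] with x hx hx'
  filter_upwards [hx, hx'] with u hu hu'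
  exact and_congr hu hu'

theorem EventuallyStable.union (hS : EventuallyStable l S S₀) (hT : EventuallyStable l T T₀) :
    EventuallyStable l (fun u ↦ S u ∪ T u) (S₀ ∪ T₀) := by
  filter_upwards [hS, hT] with x hx hx'
  filter_upwards [hx, hx'] with u hu hu'
  exact or_congr hu hu'

theorem EventuallyStable.diff (hS : EventuallyStable l S S₀) (hT : EventuallyStable l T T₀) :
    EventuallyStable l (fun u ↦ S u \ T u) (S₀ \ T₀) := by
  filter_upwards [hS, hT] with x hx hx'
  filter_upwards [hx, hx'] with u hu hu'
  exact and_congr hu (not_congr hu')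

theorem EventuallyStable.Ico {a b : ι → ℝ} {a₀ b₀ : ℝ} (ha : Tendsto a l (𝓝 a₀))
    (hb : Tendsto b l (𝓝 b₀)) :
    EventuallyStable l (fun u ↦ Set.Ico (a u) (b u)) (Set.Ico a₀ b₀) := by
  filter_upwards [ae_ne a₀, ae_ne b₀] with x hxa hxb
  have h1 : ∀ᶠ u in l, (a u ≤ x ↔ a₀ ≤ x) := by
    rcases hxa.lt_or_gt with h | h
    · filter_upwards [ha.eventually_const_lt h] with u hu
      simp [hu.not_ge, h.not_ge]
    · filter_upwards [ha.eventually_lt_const h] with u hu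
      simp [hu.le, h.le]
  have h2 : ∀ᶠ u in l, (x < b u ↔ x < b₀) := by
    rcases hxb.lt_or_gt with h | h
    · filter_upwards [hb.eventually_const_lt h] with u hu
      simp [hu, h]
    · filter_upwards [hb.eventually_lt_const h] with u hu
      exact iff_of_false hu.not_gt h.not_gt
  filter_upwards [h1, h2] with u hu hu'
  exact and_congr hu hu'

/-- Pointwise eventual equivalence does not pass to an existential over infinitely many indices;
confining all witnesses to one finite set repairs this. In the applications that set comes from a
partial section or from a bounded range of dyadic exponents. -/
theorem eventually_exists_iff [NeBot l] {β : Type*} {P : ι → β → Prop} {P₀ : β → Prop}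
    (h : ∀ i, ∀ᶠ u in l, (P u i ↔ P₀ i)) {J : Set β} (hJ : J.Finite)
    (hPJ : ∀ᶠ u in l, ∀ i, P u i → i ∈ J) : ∀ᶠ u in l, ((∃ i, P u i) ↔ ∃ i, P₀ i) := by
  -- Nontriviality of the filter carries the confinement over to the limiting predicate.
  have h0 : ∀ i, P₀ i → i ∈ J := by
    intro i hi
    obtain ⟨u, hu, hu'⟩ := ((h i).and hPJ).exists
    exact hu' i (hu.2 hi)
  filter_upwards [hPJ, (eventually_all_finite hJ).2 fun i _ ↦ h i] with u hu hu'
  constructor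
  · rintro ⟨i, hi⟩
    exact ⟨i, (hu' i (hu i hi)).1 hi⟩
  · rintro ⟨i, hi⟩
    exact ⟨i, (hu' i (h0 i hi)).2 hi⟩

theorem EventuallyStable.comp (hS : EventuallyStable l S S₀) {f : ℝ → ℝ}
    (hf : Measure.QuasiMeasurePreserving f volume volume) :
    ∀ᵐ x : ℝ, ∀ᶠ u in l, (f x ∈ S u ↔ f x ∈ S₀) := hf.ae hS

theorem quasiMeasurePreserving_dilation (j : ℤ) :
    Measure.QuasiMeasurePreserving (fun x : ℝ ↦ (2 : ℝ) ^ j * x) volume volume :=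
  quasiMeasurePreserving_mul (zpow_ne_zero _ two_ne_zero)

theorem EventuallyStable.sat_translation [NeBot l] {p : ℝ} (hS : EventuallyStable l S S₀)
    (hfin : ∀ᵐ x : ℝ, ∃ J : Set ℤ, J.Finite ∧ ∀ᶠ u in l, ∀ k : ℤ, x + k * p ∈ S u → k ∈ J) :
    EventuallyStable l (fun u ↦ sat (translationSetoid p) (S u))
      (sat (translationSetoid p) S₀) := by
  filter_upwards [hfin, ae_all_iff.2 fun k : ℤ ↦
    hS.comp (measurePreserving_translation p k).quasiMeasurePreserving] with x hx hx'
  obtain ⟨J, hJ, hPJ⟩ := hx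
  simpa only [mem_sat_translation] using eventually_exists_iff hx' hJ hPJ

theorem EventuallyStable.sat_dilation [NeBot l] (hS : EventuallyStable l S S₀)
    (hfin : ∀ᵐ x : ℝ, ∃ J : Set ℤ, J.Finite ∧
      ∀ᶠ u in l, ∀ j : ℤ, (2 : ℝ) ^ j * x ∈ S u → j ∈ J) :
    EventuallyStable l (fun u ↦ sat dilationSetoid (S u)) (sat dilationSetoid S₀) := by
  filter_upwards [hfin, ae_all_iff.2 fun j : ℤ ↦
    hS.comp (quasiMeasurePreserving_dilation j)] with x hx hx'
  obtain ⟨J, hJ, hPJ⟩ := hx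
  simpa only [mem_sat_dilation] using eventually_exists_iff hx' hJ hPJ

theorem IsPartialSection.finite_translation {p : ℝ} (hp : p ≠ 0) {S : Set ℝ}
    (hS : IsPartialSection (translationSetoid p) S) (x : ℝ) : {k : ℤ | x + k * p ∈ S}.Finite :=
  Set.Subsingleton.finite fun _ hk _ hl ↦ hS.translation_unique hp hk hl

theorem IsPartialSection.finite_dilation {S : Set ℝ} (hS : IsPartialSection dilationSetoid S)
    {x : ℝ} (hx : x ≠ 0) : {j : ℤ | (2 : ℝ) ^ j * x ∈ S}.Finite :=
  Set.Subsingleton.finite fun _ hk _ hl ↦ hS.dilation_unique hx hk hl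

theorem finite_dilation_mem_shell {c C x : ℝ} (hc : 0 < c) (hx : x ≠ 0) :
    {j : ℤ | (2 : ℝ) ^ j * x ∈ {y : ℝ | c ≤ |y| ∧ |y| ≤ C}}.Finite := by
  have hx' := abs_pos.2 hx
  rcases lt_or_ge C c with hC | hC
  · convert! Set.finite_empty
    ext j
    simp only [Set.mem_ofPred_eq, Set.mem_empty_iff_false, iff_false, not_and, not_le]
    intro h
    exact hC.trans_le h
  obtain ⟨m, hm, -⟩ := exists_mem_Ioc_zpow (div_pos hc hx') (one_lt_two)
  obtain ⟨n, -, hn⟩ := exists_mem_Ico_zpow (div_pos (hc.trans_le hC) hx') (one_lt_two)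
  refine (Set.finite_Icc m (n + 1)).subset ?_
  rintro j ⟨h1, h2⟩
  rw [abs_mul, abs_of_pos (zpow_pos two_pos _)] at h1 h2
  rw [← div_le_iff₀ hx'] at h1
  rw [← le_div_iff₀ hx'] at h2
  exact ⟨((zpow_lt_zpow_iff_right₀ one_lt_two).1 (hm.trans_le h1)).le,
    ((zpow_lt_zpow_iff_right₀ one_lt_two).1 (h2.trans_lt hn)).le⟩

/-- A subset of `K` contained in its own image under `chainStep` is null, because the step
contracts Lebesgue measure. -/
theorem volume_eq_zero_of_subset_chainStep {p : ℝ} (hp : p ≠ 0) {I K Q : Set ℝ} {ε R : ℝ}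
    (hε : 0 < ε) (hεR : 2 * ε ≤ R) (hI : MeasurableSet I) (hK : MeasurableSet K)
    (hIs : IsPartialSection dilationSetoid I) (hKr : IsPartialSection (translationSetoid p) K)
    (hIε : ∀ x ∈ I, |x| ≤ ε) (hKR : ∀ x ∈ K, R ≤ |x|) (hKfin : volume K ≠ ∞) (hQK : Q ⊆ K)
    (hQ : ∀ᵐ y : ℝ, y ∈ Q → y ∈ chainStep (translationSetoid p) dilationSetoid I K Q) :
    volume Q = 0 := by
  have hR : 0 < R := by linarith
  -- Q is not known to be measurable, so it is replaced by a measurable hull inside K of the same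
  -- outer measure.
  set Q' := toMeasurable volume Q ∩ K with hQ'
  have hQ'm : MeasurableSet Q' := (measurableSet_toMeasurable _ _).inter hK
  have hQQ' : Q ⊆ Q' := Set.subset_inter (subset_toMeasurable _ _) hQK
  have hvol : volume Q' = volume Q :=
    le_antisymm ((measure_mono Set.inter_subset_left).trans (measure_toMeasurable _).le)
      (measure_mono hQQ')
  set D := I ∩ sat dilationSetoid Q' with hD
  have hDm : MeasurableSet D := hI.inter (measurableSet_sat_dilation hQ'm)
  set U := chainStep (translationSetoid p) dilationSetoid I K Q' with hU
  have hUm : MeasurableSet U := measurableSet_chainStep p hI hK hQ'm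
  have h1 : volume Q ≤ volume U := by
    refine measure_mono_ae ?_
    filter_upwards [hQ] with y hy hyQ
    obtain ⟨hyK, x, ⟨hxI, z, hz, hxz⟩, hyx⟩ := hy hyQ
    exact ⟨hyK, x, ⟨hxI, z, hQQ' hz, hxz⟩, hyx⟩
  -- The step is undone in two moves: translations carry U into D and preserve dx; dilations carry D
  -- into Q' and preserve dx/|x|. Each move is injective on classes since K and I are partial
  -- sections of the relation in question.
  have h2 : volume U ≤ volume D :=
    volume_le_of_translates_meet (p := p) hUm.nullMeasurableSet hDm.nullMeasurableSet
      (Eventually.of_forall fun x hx ↦ mem_sat_translation.1 hx.2)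
      (Eventually.of_forall fun x k l hk hl ↦ hKr.translation_unique hp hk.1 hl.1)
  have h3 : volume D ≤ ENNReal.ofReal ε * dilationMeasure D :=
    volume_le_mul_dilationMeasure hDm hε fun x hx ↦ hIε x hx.1
  have h4 : dilationMeasure D ≤ dilationMeasure Q' :=
    dilationMeasure_le_of_dilates_meet hDm.nullMeasurableSet hQ'm.nullMeasurableSet
      (Eventually.of_forall fun x hx ↦ mem_sat_dilation.1 hx.2)
      ((ae_ne 0).mono fun x hx k l hk hl ↦ hIs.dilation_unique hx hk.1 hl.1)
  have h5 : dilationMeasure Q' ≤ ENNReal.ofReal (1 / R) * volume Q' :=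
    dilationMeasure_le_mul_volume hQ'm hR fun x hx ↦ hKR x hx.2
  have h6 : volume Q ≤ ENNReal.ofReal (1 / 2) * volume Q := by
    calc volume Q ≤ ENNReal.ofReal ε * dilationMeasure D := h1.trans (h2.trans h3)
      _ ≤ ENNReal.ofReal ε * (ENNReal.ofReal (1 / R) * volume Q') := by
        gcongr
        exact h4.trans h5
      _ = ENNReal.ofReal (ε * (1 / R)) * volume Q := by
        rw [← mul_assoc, ← ENNReal.ofReal_mul hε.le, hvol]
      _ ≤ ENNReal.ofReal (1 / 2) * volume Q := by
        gcongr
        rw [mul_one_div, div_le_div_iff₀ hR two_pos]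
        linarith
  -- The inequality μ(Q) ≤ μ(Q)/2 forces μ(Q) = 0 only for finite measure.
  have hfin : volume Q ≠ ∞ := ne_top_of_le_ne_top hKfin (measure_mono hQK)
  have h7 := ENNReal.toReal_mono (ENNReal.mul_ne_top ENNReal.ofReal_ne_top hfin) h6
  rw [ENNReal.toReal_mul, ENNReal.toReal_ofReal (by norm_num)] at h7
  have h8 : (volume Q).toReal = 0 :=
    le_antisymm (by linarith) ENNReal.toReal_nonneg
  exact ((ENNReal.toReal_eq_zero_iff _).1 h8).resolve_right hfin

variable {p ε R c C : ℝ} {A I K : ι → Set ℝ} {A₀ I₀ K₀ B : Set ℝ}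

/-- Stability of each finite stage of the chain would not be uniform in the stage. Instead the
recursion is applied once: at almost every point, instability must be inherited from an unstable
point one step away, so the unstable set lies in its own image under the contracting step. -/
theorem EventuallyStable.chainSet [NeBot l] (hp : p ≠ 0) (hA : EventuallyStable l A A₀)
    (hI : EventuallyStable l I I₀) (hK : EventuallyStable l K K₀)
    (hAB : ∀ᶠ u in l, A u ⊆ B) (hBr : IsPartialSection (translationSetoid p) B)
    (hBs : IsPartialSection dilationSetoid B)
    {D : Set ℝ} (hID : ∀ᶠ u in l, I u ⊆ D) (hDr : IsPartialSection (translationSetoid p) D)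
    (hc : 0 < c) (hKC : ∀ᶠ u in l, K u ⊆ {y : ℝ | c ≤ |y| ∧ |y| ≤ C})
    (hε : 0 < ε) (hεR : 2 * ε ≤ R) (hIm : MeasurableSet I₀) (hKm : MeasurableSet K₀)
    (hIs : IsPartialSection dilationSetoid I₀) (hKr : IsPartialSection (translationSetoid p) K₀)
    (hIε : ∀ x ∈ I₀, |x| ≤ ε) (hKR : ∀ x ∈ K₀, R ≤ |x|) (hKfin : volume K₀ ≠ ∞) :
    EventuallyStable l
      (fun u ↦ chainSet (translationSetoid p) dilationSetoid (A u) (I u) (K u))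
      (chainSet (translationSetoid p) dilationSetoid A₀ I₀ K₀) := by
  have hAsat : EventuallyStable l (fun u ↦ sat dilationSetoid (A u)) (sat dilationSetoid A₀) :=
    hA.sat_dilation ((ae_ne 0).mono fun x hx ↦ ⟨_, hBs.finite_dilation hx,
      hAB.mono fun u hu j hj ↦ hu hj⟩)
  have hstart : EventuallyStable l
      (fun u ↦ chainStart (translationSetoid p) dilationSetoid (A u) (I u) (K u))
      (chainStart (translationSetoid p) dilationSetoid A₀ I₀ K₀) := by
    refine (hK.diff (hA.sat_translation ?_)).diff ((hI.diff hAsat).sat_translation ?_)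
    · exact Eventually.of_forall fun x ↦ ⟨_, hBr.finite_translation hp x,
        hAB.mono fun u hu j hj ↦ hu hj⟩
    · exact Eventually.of_forall fun x ↦ ⟨_, hDr.finite_translation hp x,
        hID.mono fun u hu j hj ↦ hu hj.1⟩
  set Y := fun u ↦ WaveletSet.chainSet (translationSetoid p) dilationSetoid (A u) (I u) (K u)
    with hY
  set Y₀ := WaveletSet.chainSet (translationSetoid p) dilationSetoid A₀ I₀ K₀ with hY₀
  set Q : Set ℝ := {y ∈ K₀ | ¬ ∀ᶠ u in l, (y ∈ Y u ↔ y ∈ Y₀)} with hQdef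
  -- Off K₀ a stable point of K lies in neither chain, since chains stay inside K.
  have hout : ∀ y, y ∉ K₀ → (∀ᶠ u in l, (y ∈ K u ↔ y ∈ K₀)) →
      ∀ᶠ u in l, (y ∈ Y u ↔ y ∈ Y₀) := by
    intro y hy h
    filter_upwards [h] with u hu
    exact iff_of_false (fun h' ↦ hy (hu.1 (chainSet_subset h'))) (fun h' ↦ hy (chainSet_subset h'))
  have hQ0 : volume Q = 0 := by
    refine volume_eq_zero_of_subset_chainStep hp hε hεR hIm hKm hIs hKr hIε hKR hKfin
      (fun y hy ↦ hy.1) ?_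
    have hI' : ∀ᵐ y : ℝ, ∀ k : ℤ, ∀ᶠ u in l, (y + k * p ∈ I u ↔ y + k * p ∈ I₀) :=
      ae_all_iff.2 fun k ↦ hI.comp (measurePreserving_translation p k).quasiMeasurePreserving
    have hK' : ∀ᵐ y : ℝ, ∀ k j : ℤ, ∀ᶠ u in l,
        ((2 : ℝ) ^ j * (y + k * p) ∈ K u ↔ (2 : ℝ) ^ j * (y + k * p) ∈ K₀) :=
      ae_all_iff.2 fun k ↦ ae_all_iff.2 fun j ↦
        hK.comp ((quasiMeasurePreserving_dilation j).comp
          (measurePreserving_translation p k).quasiMeasurePreserving)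
    have hne : ∀ᵐ y : ℝ, ∀ k : ℤ, y + k * p ≠ 0 :=
      ae_all_iff.2 fun k ↦
        (measurePreserving_translation p k).quasiMeasurePreserving.ae (ae_ne 0)
    filter_upwards [hI', hK', hne, hstart, hK] with y hyI hyK hy0 hys hyK₀ hyQ
    -- If y is not one step away from an unstable point, every chain point it can be linked to
    -- through I₀ is stable, and then y itself is stable.
    by_contra hstep
    refine hyQ.2 ?_
    have hstab : ∀ k : ℤ, y + k * p ∈ I₀ → ∀ j : ℤ, ∀ᶠ u in l,
        ((2 : ℝ) ^ j * (y + k * p) ∈ Y u ↔ (2 : ℝ) ^ j * (y + k * p) ∈ Y₀) := by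
      intro k hk j
      by_cases hz : (2 : ℝ) ^ j * (y + k * p) ∈ K₀
      · by_contra hcon
        exact hstep ⟨hyQ.1, _, ⟨hk, _, ⟨hz, hcon⟩, j, rfl⟩, k, rfl⟩
      · exact hout _ hz (hyK k j)
    -- For fixed k only finitely many exponents j land in the shell containing K; afterwards only
    -- finitely many k matter because the sets I lie in the common section D.
    have hone : ∀ k : ℤ, ∀ᶠ u in l,
        ((y + k * p ∈ I u ∧ ∃ j : ℤ, (2 : ℝ) ^ j * (y + k * p) ∈ Y u) ↔
          (y + k * p ∈ I₀ ∧ ∃ j : ℤ, (2 : ℝ) ^ j * (y + k * p) ∈ Y₀)) := by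
      intro k
      by_cases hk : y + k * p ∈ I₀
      · have := eventually_exists_iff (hstab k hk)
          (finite_dilation_mem_shell (c := c) (C := C) hc (hy0 k))
          (hKC.mono fun u hu j hj ↦ hu (chainSet_subset hj))
        filter_upwards [this, hyI k] with u hu hu'
        exact and_congr hu' hu
      · filter_upwards [hyI k] with u hu
        exact iff_of_false (fun h ↦ hk (hu.1 h.1)) (fun h ↦ hk h.1)
    have hall := eventually_exists_iff hone (hDr.finite_translation hp y)
      (hID.mono fun u hu k hk ↦ hu hk.1)
    have key : ∀ (A I K : Set ℝ),
        y ∈ WaveletSet.chainSet (translationSetoid p) dilationSetoid A I K ↔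
        y ∈ chainStart (translationSetoid p) dilationSetoid A I K ∨ (y ∈ K ∧
          ∃ k : ℤ, y + k * p ∈ I ∧ ∃ j : ℤ, (2 : ℝ) ^ j * (y + k * p) ∈
            WaveletSet.chainSet (translationSetoid p) dilationSetoid A I K) := by
      intro A I K
      rw [mem_chainSet_iff]
      refine or_congr Iff.rfl (and_congr Iff.rfl ⟨?_, ?_⟩)
      · rintro ⟨x, hx, ⟨k, rfl⟩, z, hz, ⟨j, rfl⟩⟩
        exact ⟨k, hx, j, hz⟩
      · rintro ⟨k, hk, j, hj⟩
        exact ⟨_, hk, ⟨k, rfl⟩, _, hj, ⟨j, rfl⟩⟩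
    filter_upwards [hall, hys, hyK₀] with u h1 h2 h3
    simp only [hY, hY₀] at h1 ⊢
    rw [key (A u), key A₀]
    exact or_congr h2 (and_congr h3 h1)
  filter_upwards [measure_eq_zero_iff_ae_notMem.1 hQ0, hK] with y hy hyK
  by_cases hyK₀ : y ∈ K₀
  · by_contra h
    exact hy ⟨hyK₀, h⟩
  · exact hout y hyK₀ hyK

theorem EventuallyStable.commonSection [NeBot l] (hp : p ≠ 0) (hA : EventuallyStable l A A₀)
    (hI : EventuallyStable l I I₀) (hK : EventuallyStable l K K₀)
    (hAB : ∀ᶠ u in l, A u ⊆ B) (hBr : IsPartialSection (translationSetoid p) B)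
    (hBs : IsPartialSection dilationSetoid B)
    {D : Set ℝ} (hID : ∀ᶠ u in l, I u ⊆ D) (hDr : IsPartialSection (translationSetoid p) D)
    (hc : 0 < c) (hKC : ∀ᶠ u in l, K u ⊆ {y : ℝ | c ≤ |y| ∧ |y| ≤ C})
    (hε : 0 < ε) (hεR : 2 * ε ≤ R) (hIm : MeasurableSet I₀) (hKm : MeasurableSet K₀)
    (hIs : IsPartialSection dilationSetoid I₀) (hKr : IsPartialSection (translationSetoid p) K₀)
    (hIε : ∀ x ∈ I₀, |x| ≤ ε) (hKR : ∀ x ∈ K₀, R ≤ |x|) (hKfin : volume K₀ ≠ ∞) :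
    EventuallyStable l
      (fun u ↦ commonSection (translationSetoid p) dilationSetoid (A u) (I u) (K u))
      (commonSection (translationSetoid p) dilationSetoid A₀ I₀ K₀) := by
  have hY := EventuallyStable.chainSet hp hA hI hK hAB hBr hBs hID hDr hc hKC hε hεR hIm hKm hIs
    hKr hIε hKR hKfin
  refine (hA.union hY).union ((hI.diff (hA.sat_dilation ?_)).diff (hY.sat_dilation ?_))
  · exact (ae_ne 0).mono fun x hx ↦ ⟨_, hBs.finite_dilation hx, hAB.mono fun u hu j hj ↦ hu hj⟩
  · exact (ae_ne 0).mono fun x hx ↦ ⟨_, finite_dilation_mem_shell (c := c) (C := C) hc hx,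
      hKC.mono fun u hu j hj ↦ hu (chainSet_subset hj)⟩

end Stable

/-! ### The explicit sections of the two relations -/

/-- The set `[-ε, -ε/2) ∪ [ε/2, ε)`, which meets every dilation orbit other than `{0}` once. -/
def annulus (ε : ℝ) : Set ℝ := Set.Ico (-ε) (-(ε / 2)) ∪ Set.Ico (ε / 2) ε

theorem measurableSet_annulus (ε : ℝ) : MeasurableSet (annulus ε) :=
  measurableSet_Ico.union measurableSet_Ico

theorem abs_of_mem_annulus {ε x : ℝ} (hε : 0 < ε) (hx : x ∈ annulus ε) :
    ε / 2 ≤ |x| ∧ |x| ≤ ε := by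
  rcases hx with ⟨h1, h2⟩ | ⟨h1, h2⟩
  · rw [abs_of_neg (by linarith)]
    constructor <;> linarith
  · rw [abs_of_pos (by linarith)]
    constructor <;> linarith

theorem annulus_subset {ε : ℝ} (hε : 0 < ε) : annulus ε ⊆ Set.Ico (-ε) ε := by
  rintro x (⟨h1, h2⟩ | ⟨h1, h2⟩) <;> constructor <;> linarith

theorem eq_of_dilation_of_abs_lt {x y : ℝ} (h : dilationSetoid x y) (h1 : |y| < 2 * |x|)
    (h2 : |x| < 2 * |y|) : x = y := by
  obtain ⟨j, rfl⟩ := h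
  have hx : 0 < |x| := by
    rcases (abs_nonneg x).eq_or_lt with h | h
    · have := abs_nonneg ((2 : ℝ) ^ j * x)
      linarith
    · exact h
  rw [abs_mul, abs_of_pos (a := (2 : ℝ) ^ j) (zpow_pos two_pos _)] at h1 h2
  have h3 : (2 : ℝ) ^ j < 2 ^ (1 : ℤ) := by
    rw [zpow_one]
    exact lt_of_mul_lt_mul_right h1 hx.le
  have h4 : (2 : ℝ) ^ (0 : ℤ) < 2 ^ (j + 1) := by
    rw [zpow_zero, zpow_add₀ two_ne_zero, zpow_one]
    nlinarith
  have h5 := (zpow_lt_zpow_iff_right₀ one_lt_two).1 h3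
  have h6 := (zpow_lt_zpow_iff_right₀ one_lt_two).1 h4
  obtain rfl : j = 0 := by lia
  simp

theorem isPartialSection_annulus {ε : ℝ} (hε : 0 < ε) :
    IsPartialSection dilationSetoid (annulus ε) := by
  intro x hx y hy hxy
  have hsign : 0 < x ↔ 0 < y := by
    obtain ⟨j, rfl⟩ := hxy
    rw [mul_pos_iff_of_pos_left (zpow_pos two_pos _)]
  refine eq_of_dilation_of_abs_lt hxy ?_ ?_ <;>
  · rcases hx with ⟨h1, h2⟩ | ⟨h1, h2⟩ <;> rcases hy with ⟨h3, h4⟩ | ⟨h3, h4⟩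
    · rw [abs_of_neg (by linarith), abs_of_neg (by linarith)]
      linarith
    · exact absurd (hsign.2 (by linarith)) (by linarith)
    · exact absurd (hsign.1 (by linarith)) (by linarith)
    · rw [abs_of_pos (by linarith), abs_of_pos (by linarith)]
      linarith

theorem mem_sat_annulus {ε : ℝ} (hε : 0 < ε) {x : ℝ} (hx : x ≠ 0) :
    x ∈ sat dilationSetoid (annulus ε) := by
  rw [mem_sat_dilation]
  rcases hx.lt_or_gt with hx | hx
  -- The negative half of the annulus contains -ε but not -ε/2, so the dyadic interval is closed on
  -- the opposite side from the one used for positive x.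
  · obtain ⟨n, h1, h2⟩ := exists_mem_Ioc_zpow (div_pos (mul_pos two_pos (neg_pos.2 hx)) hε)
      one_lt_two
    have hn : (0 : ℝ) < 2 ^ n := zpow_pos two_pos _
    rw [zpow_add₀ two_ne_zero, zpow_one, div_le_iff₀ hε] at h2
    rw [lt_div_iff₀ hε] at h1
    refine ⟨-n, Or.inl ⟨?_, ?_⟩⟩
    · rw [zpow_neg, inv_mul_eq_div, le_div_iff₀ hn]
      linarith
    · rw [zpow_neg, inv_mul_eq_div, div_lt_iff₀ hn]
      linarith
  · obtain ⟨n, h1, h2⟩ := exists_mem_Ico_zpow (div_pos (mul_pos two_pos hx) hε) one_lt_two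
    have hn : (0 : ℝ) < 2 ^ n := zpow_pos two_pos _
    rw [zpow_add₀ two_ne_zero, zpow_one, div_lt_iff₀ hε] at h2
    rw [le_div_iff₀ hε] at h1
    refine ⟨-n, Or.inr ⟨?_, ?_⟩⟩
    · rw [zpow_neg, inv_mul_eq_div, le_div_iff₀ hn]
      linarith
    · rw [zpow_neg, inv_mul_eq_div, div_lt_iff₀ hn]
      linarith

theorem isPartialSection_Ico_translation {p a b : ℝ} (hp : 0 < p) (hab : b - a ≤ p) :
    IsPartialSection (translationSetoid p) (Set.Ico a b) := by
  rintro x ⟨hx1, hx2⟩ y ⟨hy1, hy2⟩ ⟨k, rfl⟩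
  have h1 : (k : ℝ) < 1 := by
    have : (k : ℝ) * p < 1 * p := by linarith
    exact lt_of_mul_lt_mul_right this hp.le
  have h2 : (-1 : ℝ) < k := by
    have : (-1 : ℝ) * p < k * p := by linarith
    exact lt_of_mul_lt_mul_right this hp.le
  have h1' : k < 1 := by exact_mod_cast h1
  have h2' : -1 < k := by exact_mod_cast h2
  obtain rfl : k = 0 := by lia
  simp

theorem isPartialSection_Ico_dilation {a b : ℝ} (ha : 0 < a) (hab : b ≤ 2 * a) :
    IsPartialSection dilationSetoid (Set.Ico a b) := by
  rintro x ⟨hx1, hx2⟩ y ⟨hy1, hy2⟩ hxy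
  refine eq_of_dilation_of_abs_lt hxy ?_ ?_ <;>
  · rw [abs_of_pos (by linarith), abs_of_pos (by linarith)]
    linarith

theorem mem_sat_Ico {p : ℝ} (hp : 0 < p) (R x : ℝ) :
    x ∈ sat (translationSetoid p) (Set.Ico R (R + p)) := by
  rw [mem_sat_translation]
  obtain ⟨k, hk, -⟩ := existsUnique_add_zsmul_mem_Ico hp x R
  exact ⟨k, by simpa using hk⟩

/-! ### Sections through a prescribed set -/

/-- The part of `A₀` that leaves room for the translation classes of `[-ε, ε)` and the dilation
classes of `[R, R + p)`. -/
def trimmed (p : ℝ) (A₀ : Set ℝ) (ε R : ℝ) : Set ℝ :=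
  (A₀ \ sat (translationSetoid p) (Set.Ico (-ε) ε)) \ sat dilationSetoid (Set.Ico R (R + p))

/-- A common section of translations by `p` and dilations by `2` that contains
`trimmed p A₀ ε R`. -/
def extendedSection (p : ℝ) (A₀ : Set ℝ) (ε R : ℝ) : Set ℝ :=
  commonSection (translationSetoid p) dilationSetoid (trimmed p A₀ ε R) (annulus ε)
    (Set.Ico R (R + p))

theorem trimmed_subset {p ε R : ℝ} {A₀ : Set ℝ} : trimmed p A₀ ε R ⊆ A₀ := fun _ h ↦ h.1.1

theorem trimmed_subset_extendedSection {p ε R : ℝ} {A₀ : Set ℝ} :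
    trimmed p A₀ ε R ⊆ extendedSection p A₀ ε R := subset_commonSection

theorem measurableSet_trimmed {p ε R : ℝ} {A₀ : Set ℝ} (hA : MeasurableSet A₀) :
    MeasurableSet (trimmed p A₀ ε R) :=
  (hA.diff (measurableSet_sat_translation p measurableSet_Ico)).diff
    (measurableSet_sat_dilation measurableSet_Ico)

theorem measurableSet_extendedSection {p ε R : ℝ} {A₀ : Set ℝ} (hA : MeasurableSet A₀) :
    MeasurableSet (extendedSection p A₀ ε R) :=
  measurableSet_commonSection p (measurableSet_trimmed hA) (measurableSet_annulus ε)
    measurableSet_Ico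

/-- The bound 2ε ≤ p makes the annulus a partial section for translations, and [R, R + p) supplies
the covering. In the dilation statement that follows the roles are exchanged, with p ≤ R making [R,
R + p) a partial section. -/
theorem tilesByTranslation_extendedSection {p ε R : ℝ} {A₀ : Set ℝ} (hp : 0 < p) (hε : 0 < ε)
    (hεp : 2 * ε ≤ p) (hA : IsPartialSection (translationSetoid p) A₀) :
    TilesByTranslation p (extendedSection p A₀ ε R) := by
  refine tilesByTranslation_of_section hp.ne' (isPartialSection_commonSection_left
    (hA.mono trimmed_subset)
    ((isPartialSection_Ico_translation hp (by linarith)).mono (annulus_subset hε))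
    (isPartialSection_Ico_translation hp (by linarith)) ?_)
    fun x ↦ mem_sat_commonSection_left (mem_sat_Ico hp R x)
  rw [Set.disjoint_left]
  rintro x hx ⟨a, ha, hxa⟩
  exact ha.1.2 ⟨x, annulus_subset hε hx, (translationSetoid p).symm hxa⟩

theorem tilesByDilation_extendedSection {p ε R : ℝ} {A₀ : Set ℝ} (hε : 0 < ε) (hR : 0 < R)
    (hpR : p ≤ R) (hA : IsPartialSection dilationSetoid A₀) :
    TilesByDilation (extendedSection p A₀ ε R) := by
  refine tilesByDilation_of_section (isPartialSection_commonSection_right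
    (hA.mono trimmed_subset) (isPartialSection_annulus hε)
    (isPartialSection_Ico_dilation hR (by linarith)) ?_)
    fun x hx ↦ mem_sat_commonSection_right (mem_sat_annulus hε hx)
  rw [Set.disjoint_left]
  rintro x hx ⟨a, ha, hxa⟩
  exact ha.2 ⟨x, hx, dilationSetoid.symm hxa⟩

/-- When `[-ε, ε)` meets all translation classes nothing of `A₀` is left. -/
theorem trimmed_eq_empty {p : ℝ} (hp : 0 < p) (A₀ : Set ℝ) (R : ℝ) :
    trimmed p A₀ (p / 2) R = ∅ := by
  refine Set.eq_empty_of_forall_notMem fun x hx ↦ hx.1.2 ?_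
  have := mem_sat_Ico hp (-(p / 2)) x
  rwa [show -(p / 2) + p = p / 2 by ring] at this

/-! ### Continuity in the parameters ε and R away from the endpoint -/

section Continuity

variable {ι : Type*} {l : Filter ι} {p ε₀ R₀ : ℝ} {ε R : ι → ℝ} {A₀ : Set ℝ}

theorem eventuallyStable_extendedSection [NeBot l] (hp : 0 < p) (hε : Tendsto ε l (𝓝 ε₀))
    (hR : Tendsto R l (𝓝 R₀)) (hε0 : 0 < ε₀) (hεp : ∀ᶠ u in l, 0 < ε u ∧ 2 * ε u ≤ p)
    (hε₀p : 2 * ε₀ ≤ p) (hR₀ : p ≤ R₀)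
    (hAr : IsPartialSection (translationSetoid p) A₀) (hAs : IsPartialSection dilationSetoid A₀) :
    EventuallyStable l (fun u ↦ extendedSection p A₀ (ε u) (R u)) (extendedSection p A₀ ε₀ R₀) := by
  have hRpos : 0 < R₀ := by linarith
  have hI : EventuallyStable l (fun u ↦ annulus (ε u)) (annulus ε₀) :=
    (EventuallyStable.Ico hε.neg (hε.div_const 2).neg).union
      (EventuallyStable.Ico (hε.div_const 2) hε)
  have hK : EventuallyStable l (fun u ↦ Set.Ico (R u) (R u + p)) (Set.Ico R₀ (R₀ + p)) :=
    EventuallyStable.Ico hR (hR.add_const p)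
  have hKC : ∀ᶠ u in l, Set.Ico (R u) (R u + p) ⊆
      {y : ℝ | R₀ / 2 ≤ |y| ∧ |y| ≤ 2 * R₀ + p} := by
    filter_upwards [hR.eventually_const_lt (show R₀ / 2 < R₀ by linarith),
      hR.eventually_lt_const (show R₀ < 2 * R₀ by linarith)] with u h1 h2 y hy
    have : 0 < y := by linarith [hy.1]
    simp only [Set.mem_ofPred_eq, abs_of_pos this]
    constructor <;> linarith [hy.1, hy.2]
  -- A single translation section containing all the annuli, so the finite index sets do not depend
  -- on u.
  have hD : IsPartialSection (translationSetoid p) (Set.Ico (-(p / 2)) (p / 2)) :=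
    isPartialSection_Ico_translation hp (by linarith)
  have hsub : ∀ᶠ u in l, Set.Ico (-ε u) (ε u) ⊆ Set.Ico (-(p / 2)) (p / 2) :=
    hεp.mono fun u hu ↦ Set.Ico_subset_Ico (by linarith) (by linarith)
  have hA : EventuallyStable l (fun u ↦ trimmed p A₀ (ε u) (R u)) (trimmed p A₀ ε₀ R₀) := by
    refine ((EventuallyStable.const A₀).diff
      ((EventuallyStable.Ico hε.neg hε).sat_translation ?_)).diff (hK.sat_dilation ?_)
    · exact Eventually.of_forall fun x ↦ ⟨_, hD.finite_translation hp.ne' x,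
        hsub.mono fun u hu k hk ↦ hu hk⟩
    · exact (ae_ne 0).mono fun x hx ↦ ⟨_, finite_dilation_mem_shell (half_pos hRpos) hx,
        hKC.mono fun u hu j hj ↦ hu hj⟩
  refine EventuallyStable.commonSection (B := A₀) hp.ne' hA hI hK
    (Eventually.of_forall fun u ↦ trimmed_subset) hAr hAs
    ((hεp.and hsub).mono fun u hu ↦ (annulus_subset hu.1.1).trans hu.2) hD (half_pos hRpos) hKC
    hε0 (hε₀p.trans hR₀) (measurableSet_annulus _) measurableSet_Ico (isPartialSection_annulus hε0)
    (isPartialSection_Ico_translation hp (by linarith)) (fun x hx ↦ (abs_of_mem_annulus hε0 hx).2)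
    ?_ (by simp)
  intro x hx
  exact hx.1.trans (le_abs_self x)

/-- Dominated convergence: stability says that the indicators of the symmetric differences tend to 0
almost everywhere, and Z is a dominating set of finite measure. -/
theorem EventuallyStable.tendsto_symmDiff [l.IsCountablyGenerated] {S : ι → Set ℝ} {S₀ Z : Set ℝ}
    (h : EventuallyStable l S S₀) {m : Measure ℝ} (hm : m ≪ volume)
    (hS : ∀ u, MeasurableSet (S u)) (hS₀ : MeasurableSet S₀) (hZ : MeasurableSet Z)
    (hmZ : m Z ≠ ∞) (hSZ : ∀ᶠ u in l, S u ⊆ Z) (hS₀Z : S₀ ⊆ Z) :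
    Tendsto (fun u ↦ m (symmDiff (S u) S₀)) l (𝓝 0) := by
  rw [← measure_empty (μ := m)]
  refine tendsto_measure_of_ae_tendsto_indicator l MeasurableSet.empty
    (fun u ↦ (hS u).symmDiff hS₀) hZ hmZ ?_ ?_
  · filter_upwards [hSZ] with u hu
    rintro x (hx | hx)
    · exact hu hx.1
    · exact hS₀Z hx.1
  · filter_upwards [hm.ae_le h] with x hx
    filter_upwards [hx] with u hu
    simp [Set.mem_symmDiff, hu]

theorem volume_shell_ne_top (c C : ℝ) : volume {y : ℝ | c ≤ |y| ∧ |y| ≤ C} ≠ ∞ := by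
  refine ne_top_of_le_ne_top (b := volume (Set.Icc (-C) C)) (by simp) (measure_mono ?_)
  exact fun y hy ↦ abs_le.1 hy.2

theorem measurableSet_shell (c C : ℝ) : MeasurableSet {y : ℝ | c ≤ |y| ∧ |y| ≤ C} :=
  (measurableSet_le measurable_const continuous_abs.measurable).inter
    (measurableSet_le continuous_abs.measurable measurable_const)

theorem dilationMeasure_shell_ne_top {c : ℝ} (hc : 0 < c) (C : ℝ) :
    dilationMeasure {y : ℝ | c ≤ |y| ∧ |y| ≤ C} ≠ ∞ :=
  ne_top_of_le_ne_top (ENNReal.mul_ne_top ENNReal.ofReal_ne_top (volume_shell_ne_top c C))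
    (dilationMeasure_le_mul_volume (measurableSet_shell c C) hc fun _ h ↦ h.1)

theorem waveletSetDist_eq (W W' : Set ℝ) :
    waveletSetDist W W' = volume (symmDiff W W') ^ (1 / 2 : ℝ) +
      dilationMeasure (symmDiff W W') ^ (1 / 2 : ℝ) := by
  rw [waveletSetDist, dilationMeasure, withDensity_apply']

theorem tendsto_waveletSetDist {S : ι → Set ℝ} {S₀ : Set ℝ}
    (h1 : Tendsto (fun u ↦ volume (symmDiff (S u) S₀)) l (𝓝 0))
    (h2 : Tendsto (fun u ↦ dilationMeasure (symmDiff (S u) S₀)) l (𝓝 0)) :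
    Tendsto (fun u ↦ waveletSetDist (S u) S₀) l (𝓝 0) := by
  simp_rw [waveletSetDist_eq]
  have h0 : (0 : ℝ≥0∞) ^ (1 / 2 : ℝ) = 0 := ENNReal.zero_rpow_of_pos (by norm_num)
  have := (h1.ennrpow_const (1 / 2 : ℝ)).add (h2.ennrpow_const (1 / 2 : ℝ))
  rwa [h0, add_zero] at this

theorem volume_ne_top_of_isPartialSection (hp : 0 < p) {S : Set ℝ} (hS : MeasurableSet S)
    (h : IsPartialSection (translationSetoid p) S) : volume S ≠ ∞ := by
  refine ne_top_of_le_ne_top (b := volume (Set.Ico 0 (0 + p))) (by simp) ?_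
  exact volume_le_of_translates_meet (p := p) hS.nullMeasurableSet
    measurableSet_Ico.nullMeasurableSet
    (Eventually.of_forall fun x _ ↦ mem_sat_translation.1 (mem_sat_Ico hp 0 x))
    (Eventually.of_forall fun x k l hk hl ↦ h.translation_unique hp.ne' hk hl)

theorem dilationMeasure_ne_top_of_isPartialSection {S : Set ℝ} (hS : MeasurableSet S)
    (h : IsPartialSection dilationSetoid S) : dilationMeasure S ≠ ∞ := by
  refine ne_top_of_le_ne_top (dilationMeasure_shell_ne_top (c := 1 / 2) (by norm_num) 1) ?_
  refine (dilationMeasure_le_of_dilates_meet hS.nullMeasurableSet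
    (measurableSet_annulus 1).nullMeasurableSet
    ((ae_ne 0).mono fun x hx _ ↦ mem_sat_dilation.1 (mem_sat_annulus one_pos hx))
    ((ae_ne 0).mono fun x hx k l hk hl ↦ h.dilation_unique hx hk hl)).trans (measure_mono ?_)
  exact fun x hx ↦ abs_of_mem_annulus one_pos hx

theorem tendsto_waveletSetDist_extendedSection [NeBot l] [l.IsCountablyGenerated] (hp : 0 < p)
    (hε : Tendsto ε l (𝓝 ε₀)) (hR : Tendsto R l (𝓝 R₀)) (hε0 : 0 < ε₀)
    (hεp : ∀ᶠ u in l, 0 < ε u ∧ 2 * ε u ≤ p) (hε₀p : 2 * ε₀ ≤ p) (hR₀ : p ≤ R₀)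
    (hAm : MeasurableSet A₀) (hAr : IsPartialSection (translationSetoid p) A₀)
    (hAs : IsPartialSection dilationSetoid A₀) :
    Tendsto (fun u ↦ waveletSetDist (extendedSection p A₀ (ε u) (R u))
      (extendedSection p A₀ ε₀ R₀)) l (𝓝 0) := by
  have hst := eventuallyStable_extendedSection hp hε hR hε0 hεp hε₀p hR₀ hAr hAs
  have hRpos : 0 < R₀ := by linarith
  -- For ε > ε₀/2 the annulus stays at distance at least ε₀/4 from 0. The shell therefore has finite
  -- measure for both dx and dx/|x|, and so does A₀, being a partial section of both relations.
  set Z := A₀ ∪ {y : ℝ | ε₀ / 4 ≤ |y| ∧ |y| ≤ 2 * R₀ + p} with hZ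
  have hsub : ∀ e r, ε₀ / 2 < e → 2 * e ≤ p → R₀ / 2 < r → r < 2 * R₀ →
      extendedSection p A₀ e r ⊆ Z := by
    intro e r h1 h2 h3 h4 x hx
    rcases commonSection_subset hx with (h | h) | h
    · exact Or.inl (trimmed_subset h)
    · have : 0 < x := by linarith [h.1]
      refine Or.inr ?_
      simp only [Set.mem_ofPred_eq, abs_of_pos this]
      constructor <;> linarith [h.1, h.2]
    · have := abs_of_mem_annulus (by linarith) h
      exact Or.inr ⟨by linarith, by linarith⟩
  have hZm : MeasurableSet Z := hAm.union (measurableSet_shell _ _)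
  have hSZ : ∀ᶠ u in l, extendedSection p A₀ (ε u) (R u) ⊆ Z := by
    filter_upwards [hεp, hε.eventually_const_lt (show ε₀ / 2 < ε₀ by linarith),
      hR.eventually_const_lt (show R₀ / 2 < R₀ by linarith),
      hR.eventually_lt_const (show R₀ < 2 * R₀ by linarith)] with u h1 h2 h3 h4
    exact hsub _ _ h2 h1.2 h3 h4
  have hS₀Z : extendedSection p A₀ ε₀ R₀ ⊆ Z :=
    hsub _ _ (by linarith) hε₀p (by linarith) (by linarith)
  refine tendsto_waveletSetDist
    (hst.tendsto_symmDiff Measure.AbsolutelyContinuous.rfl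
      (fun u ↦ measurableSet_extendedSection hAm) (measurableSet_extendedSection hAm) hZm ?_ hSZ
      hS₀Z)
    (hst.tendsto_symmDiff dilationMeasure_ac
      (fun u ↦ measurableSet_extendedSection hAm) (measurableSet_extendedSection hAm) hZm ?_ hSZ
      hS₀Z)
  · exact (measure_union_lt_top (volume_ne_top_of_isPartialSection hp hAm hAr).lt_top
      (volume_shell_ne_top _ _).lt_top).ne
  · exact (measure_union_lt_top (dilationMeasure_ne_top_of_isPartialSection hAm hAs).lt_top
      (dilationMeasure_shell_ne_top (by linarith) _).lt_top).ne

end Continuity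

/-! ### Convergence to the prescribed set -/

theorem TilesByTranslation.congr {p : ℝ} {W W' : Set ℝ} (hW : TilesByTranslation p W)
    (h : W =ᵐ[volume] W') : TilesByTranslation p W' := by
  have : ∀ᵐ x : ℝ, ∀ k : ℤ, (x + k * p ∈ W ↔ x + k * p ∈ W') :=
    ae_all_iff.2 fun k ↦ (measurePreserving_translation p k).quasiMeasurePreserving.ae
      (eventuallyEq_set.1 h)
  filter_upwards [hW, this] with x hx hx'
  simpa only [← hx'] using hx

theorem TilesByDilation.congr {W W' : Set ℝ} (hW : TilesByDilation W)
    (h : W =ᵐ[volume] W') : TilesByDilation W' := by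
  have : ∀ᵐ x : ℝ, ∀ j : ℤ, ((2 : ℝ) ^ j * x ∈ W ↔ (2 : ℝ) ^ j * x ∈ W') :=
    ae_all_iff.2 fun j ↦ (quasiMeasurePreserving_dilation j).ae (eventuallyEq_set.1 h)
  filter_upwards [hW, this] with x hx hx'
  simpa only [← hx'] using hx

/-- A set tiling by translations and dilations contains a measurable set of full measure all of
whose points are pairwise inequivalent. -/
theorem exists_isPartialSection_ae_eq {p : ℝ} {W : Set ℝ} (hm : NullMeasurableSet W)
    (ht : TilesByTranslation p W) (hd : TilesByDilation W) :
    ∃ A : Set ℝ, MeasurableSet A ∧ A =ᵐ[volume] W ∧ IsPartialSection (translationSetoid p) A ∧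
      IsPartialSection dilationSetoid A := by
  obtain ⟨V, hVW, hVm, hVae⟩ := hm.exists_measurable_subset_ae_eq
  -- Keep only the points of V with no other translate or dilate in V; the tiling hypotheses make
  -- the rest null.
  set A : Set ℝ := V ∩ ((⋂ k : ℤ, {x | x + k * p ∈ V → k = 0}) ∩
    ⋂ j : ℤ, {x | (2 : ℝ) ^ j * x ∈ V → j = 0}) with hA
  have hmem : ∀ x, x ∈ A ↔ x ∈ V ∧ (∀ k : ℤ, x + k * p ∈ V → k = 0) ∧
      ∀ j : ℤ, (2 : ℝ) ^ j * x ∈ V → j = 0 := by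
    intro x
    simp [hA]
  refine ⟨A, ?_, ?_, ?_, ?_⟩
  · refine hVm.inter ((MeasurableSet.iInter fun k ↦ ?_).inter (MeasurableSet.iInter fun j ↦ ?_))
    · exact ((measurable_add_const _) hVm).imp (MeasurableSet.const _)
    · exact ((measurable_const_mul _) hVm).imp (MeasurableSet.const _)
  · refine EventuallyEq.trans ?_ hVae
    rw [eventuallyEq_set]
    filter_upwards [ht, hd] with x hx hx'
    rw [hmem]
    refine ⟨fun h ↦ h.1, fun h ↦ ⟨h, fun k hk ↦ ?_, fun j hj ↦ ?_⟩⟩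
    · exact hx.unique (hVW hk) (by simpa using hVW h)
    · exact hx'.unique (hVW hj) (by simpa using hVW h)
  · rintro x hx _ hy ⟨k, rfl⟩
    obtain rfl := ((hmem x).1 hx).2.1 k ((hmem _).1 hy).1
    simp
  · rintro x hx _ hy ⟨k, rfl⟩
    obtain rfl := ((hmem x).1 hx).2.2 k ((hmem _).1 hy).1
    simp

/-- Two sets of equal finite measure stay equal in measure after removing a common part T. Applied
with T the trimmed set, this bounds the added part by the deleted one, with no information about the
chain. -/
theorem measure_symmDiff_le_of_measure_eq {m : Measure ℝ} {S A T : Set ℝ} (hT : MeasurableSet T)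
    (hTS : T ⊆ S) (hTA : T ⊆ A) (hSA : m S = m A) (hA : m A ≠ ∞) :
    m (symmDiff S A) ≤ 2 * m (A \ T) := by
  have hTfin : m T ≠ ∞ := ne_top_of_le_ne_top hA (measure_mono hTA)
  have h1 : m (S \ T) = m (A \ T) := by
    rw [measure_sdiff hTS hT.nullMeasurableSet hTfin, measure_sdiff hTA hT.nullMeasurableSet hTfin,
      hSA]
  calc m (symmDiff S A) ≤ m (S \ T ∪ A \ T) := by
        refine measure_mono ?_
        rintro x (hx | hx)
        · exact Or.inl ⟨hx.1, fun h ↦ hx.2 (hTA h)⟩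
        · exact Or.inr ⟨hx.1, fun h ↦ hx.2 (hTS h)⟩
    _ ≤ m (S \ T) + m (A \ T) := measure_union_le _ _
    _ = 2 * m (A \ T) := by rw [h1, two_mul]

theorem tendsto_setLIntegral_zero_of_subset {ι : Type*} {l : Filter ι} {m : Measure ℝ}
    {f : ℝ → ℝ≥0∞} {A : Set ℝ} (hA : ∫⁻ x in A, f x ∂m ≠ ∞) {B : ι → Set ℝ}
    (hB : ∀ u, MeasurableSet (B u)) (hBA : ∀ u, B u ⊆ A)
    (h : Tendsto (fun u ↦ m (B u)) l (𝓝 0)) :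
    Tendsto (fun u ↦ ∫⁻ x in B u, f x ∂m) l (𝓝 0) := by
  have h1 : ∀ u, (m.restrict A).restrict (B u) = m.restrict (B u) := fun u ↦ by
    rw [Measure.restrict_restrict (hB u), Set.inter_eq_left.2 (hBA u)]
  have h2 : Tendsto (fun u ↦ (m.restrict A) (B u)) l (𝓝 0) := by
    refine h.congr fun u ↦ ?_
    rw [Measure.restrict_apply (hB u), Set.inter_eq_left.2 (hBA u)]
  simpa only [h1] using tendsto_setLIntegral_zero hA h2

theorem volume_eq_setLIntegral_dilationMeasure {S : Set ℝ} (hS : MeasurableSet S) :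
    volume S = ∫⁻ x in S, ENNReal.ofReal |x| ∂dilationMeasure := by
  rw [dilationMeasure, setLIntegral_withDensity_eq_setLIntegral_mul _
    measurable_ofReal_one_div_abs (by fun_prop) hS, ← setLIntegral_one]
  refine lintegral_congr_ae ?_
  filter_upwards [ae_restrict_of_ae (ae_ne 0)] with x hx
  rw [Pi.mul_apply, ← ENNReal.ofReal_mul (by positivity), one_div,
    inv_mul_cancel₀ (abs_ne_zero.2 hx), ENNReal.ofReal_one]

section Endpoint

variable {ι : Type*} {l : Filter ι} {p : ℝ} {ε R : ι → ℝ} {A₀ : Set ℝ}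

theorem diff_trimmed_eq (p : ℝ) (A₀ : Set ℝ) (ε R : ℝ) :
    A₀ \ trimmed p A₀ ε R = A₀ ∩ sat (translationSetoid p) (Set.Ico (-ε) ε) ∪
      A₀ ∩ sat dilationSetoid (Set.Ico R (R + p)) := by
  ext x
  simp only [trimmed, Set.mem_sdiff, Set.mem_union, Set.mem_inter_iff]
  tauto

/-- The part deleted for translations has Lebesgue measure at most 2ε, and the part deleted for
dilations has dx/|x| measure at most p/R. Each of the two measures has a density with respect to the
other that is integrable on A₀, so smallness passes between them by absolute continuity of the
integral. -/
theorem tendsto_measure_diff_trimmed (hp : 0 < p) (hε : Tendsto ε l (𝓝 0))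
    (hR : Tendsto R l atTop) (hA : MeasurableSet A₀)
    (hAr : IsPartialSection (translationSetoid p) A₀) (hAs : IsPartialSection dilationSetoid A₀) :
    Tendsto (fun u ↦ volume (A₀ \ trimmed p A₀ (ε u) (R u))) l (𝓝 0) ∧
      Tendsto (fun u ↦ dilationMeasure (A₀ \ trimmed p A₀ (ε u) (R u))) l (𝓝 0) := by
  set B := fun u ↦ A₀ ∩ sat (translationSetoid p) (Set.Ico (-ε u) (ε u))
  set D := fun u ↦ A₀ ∩ sat dilationSetoid (Set.Ico (R u) (R u + p))
  have hBm : ∀ u, MeasurableSet (B u) := fun u ↦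
    hA.inter (measurableSet_sat_translation p measurableSet_Ico)
  have hDm : ∀ u, MeasurableSet (D u) := fun u ↦
    hA.inter (measurableSet_sat_dilation measurableSet_Ico)
  have hB1 : Tendsto (fun u ↦ volume (B u)) l (𝓝 0) := by
    have h0 : Tendsto (fun u ↦ ENNReal.ofReal (ε u - -ε u)) l (𝓝 0) := by
      rw [← ENNReal.ofReal_zero]
      exact ENNReal.tendsto_ofReal (by simpa using hε.sub hε.neg)
    refine tendsto_of_tendsto_of_tendsto_of_le_of_le tendsto_const_nhds h0
      (fun _ ↦ zero_le) fun u ↦ ?_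
    rw [← Real.volume_Ico]
    exact volume_le_of_translates_meet (p := p) (hBm u).nullMeasurableSet
      measurableSet_Ico.nullMeasurableSet
      (Eventually.of_forall fun x hx ↦ mem_sat_translation.1 hx.2)
      (Eventually.of_forall fun x k l hk hl ↦ hAr.translation_unique hp.ne' hk.1 hl.1)
  have hD2 : Tendsto (fun u ↦ dilationMeasure (D u)) l (𝓝 0) := by
    have h0 : Tendsto (fun u ↦ ENNReal.ofReal (1 / R u * p)) l (𝓝 0) := by
      rw [← ENNReal.ofReal_zero]
      refine ENNReal.tendsto_ofReal ?_
      simpa using hR.inv_tendsto_atTop.mul_const p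
    refine tendsto_of_tendsto_of_tendsto_of_le_of_le' tendsto_const_nhds h0
      (Eventually.of_forall fun _ ↦ zero_le) ?_
    filter_upwards [hR.eventually_gt_atTop 0] with u hu
    calc dilationMeasure (D u) ≤ dilationMeasure (Set.Ico (R u) (R u + p)) :=
          dilationMeasure_le_of_dilates_meet (hDm u).nullMeasurableSet
            measurableSet_Ico.nullMeasurableSet
            (Eventually.of_forall fun x hx ↦ mem_sat_dilation.1 hx.2)
            ((ae_ne 0).mono fun x hx k l hk hl ↦ hAs.dilation_unique hx hk.1 hl.1)
      _ ≤ ENNReal.ofReal (1 / R u) * volume (Set.Ico (R u) (R u + p)) :=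
          dilationMeasure_le_mul_volume measurableSet_Ico hu
            fun x hx ↦ hx.1.trans (le_abs_self x)
      _ = ENNReal.ofReal (1 / R u * p) := by
          rw [Real.volume_Ico, ENNReal.ofReal_mul (by positivity)]
          simp
  have hνA := dilationMeasure_ne_top_of_isPartialSection hA hAs
  have hμA := volume_ne_top_of_isPartialSection hp hA hAr
  have hB2 : Tendsto (fun u ↦ dilationMeasure (B u)) l (𝓝 0) := by
    simp only [dilationMeasure, withDensity_apply'] at hνA ⊢
    exact tendsto_setLIntegral_zero_of_subset hνA hBm (fun u ↦ Set.inter_subset_left) hB1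
  have hD1 : Tendsto (fun u ↦ volume (D u)) l (𝓝 0) := by
    rw [volume_eq_setLIntegral_dilationMeasure hA] at hμA
    simp only [volume_eq_setLIntegral_dilationMeasure (hDm _)]
    exact tendsto_setLIntegral_zero_of_subset hμA hDm (fun u ↦ Set.inter_subset_left) hD2
  simp only [diff_trimmed_eq]
  constructor
  · exact tendsto_of_tendsto_of_tendsto_of_le_of_le tendsto_const_nhds
      (by simpa using hB1.add hD1) (fun _ ↦ zero_le) fun u ↦ measure_union_le _ _
  · exact tendsto_of_tendsto_of_tendsto_of_le_of_le tendsto_const_nhds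
      (by simpa using hB2.add hD2) (fun _ ↦ zero_le) fun u ↦ measure_union_le _ _

theorem tendsto_waveletSetDist_endpoint {W : Set ℝ} (hp : 0 < p) (hε : Tendsto ε l (𝓝 0))
    (hR : Tendsto R l atTop) (hεp : ∀ᶠ u in l, 0 < ε u ∧ 2 * ε u ≤ p)
    (ht : TilesByTranslation p W) (hd : TilesByDilation W)
    (hA : MeasurableSet A₀) (hAW : A₀ =ᵐ[volume] W)
    (hAr : IsPartialSection (translationSetoid p) A₀) (hAs : IsPartialSection dilationSetoid A₀) :
    Tendsto (fun u ↦ waveletSetDist (extendedSection p A₀ (ε u) (R u)) W) l (𝓝 0) := by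
  obtain ⟨h1, h2⟩ := tendsto_measure_diff_trimmed hp hε hR hA hAr hAs
  have hcongr : ∀ S : Set ℝ, (symmDiff S W : Set ℝ) =ᵐ[volume] (symmDiff S A₀ : Set ℝ) := by
    intro S
    rw [eventuallyEq_set]
    filter_upwards [eventuallyEq_set.1 hAW] with x hx
    simp [Set.mem_symmDiff, hx]
  have hνA := dilationMeasure_ne_top_of_isPartialSection hA hAs
  have hμA := volume_ne_top_of_isPartialSection hp hA hAr
  refine tendsto_waveletSetDist ?_ ?_
  · refine tendsto_of_tendsto_of_tendsto_of_le_of_le' tendsto_const_nhds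
      (by simpa using ENNReal.Tendsto.const_mul h1 (Or.inr (ENNReal.ofNat_ne_top (n := 2))))
      (Eventually.of_forall fun _ ↦ zero_le) ?_
    filter_upwards [hεp] with u hu
    rw [measure_congr (hcongr _)]
    refine measure_symmDiff_le_of_measure_eq (measurableSet_trimmed hA)
      trimmed_subset_extendedSection trimmed_subset ?_ hμA
    exact (tilesByTranslation_extendedSection hp hu.1 hu.2 hAr).volume_eq (ht.congr hAW.symm)
      (measurableSet_extendedSection hA).nullMeasurableSet hA.nullMeasurableSet
  · refine tendsto_of_tendsto_of_tendsto_of_le_of_le' tendsto_const_nhds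
      (by simpa using ENNReal.Tendsto.const_mul h2 (Or.inr (ENNReal.ofNat_ne_top (n := 2))))
      (Eventually.of_forall fun _ ↦ zero_le) ?_
    filter_upwards [hεp, hR.eventually_ge_atTop p] with u hu hu'
    rw [measure_congr (dilationMeasure_ac.ae_le (hcongr _))]
    refine measure_symmDiff_le_of_measure_eq (measurableSet_trimmed hA)
      trimmed_subset_extendedSection trimmed_subset ?_ hνA
    exact (tilesByDilation_extendedSection hu.1 (hp.trans_le hu') hu' hAs).dilationMeasure_eq
      (hd.congr hAW.symm) (measurableSet_extendedSection hA).nullMeasurableSet hA.nullMeasurableSet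

end Endpoint

/-! ### The path from a tiling set to a fixed one -/

/-- A path of tiling sets, starting at `W` and constant from time `1` on. -/
def sectionPath (p : ℝ) (A₀ W : Set ℝ) (u : ℝ) : Set ℝ :=
  -- For 0 < u the choice gives 2ε ≤ p ≤ R. As u → 0 from above, ε → 0 and R → ∞; at u = 1, ε = p/2
  -- and R = p.
  if u ≤ 0 then W else extendedSection p A₀ (p * min u 1 / 2) (p / min u 1)

section Path

variable {p u : ℝ} {A₀ W : Set ℝ}

theorem sectionPath_of_nonpos (hu : u ≤ 0) : sectionPath p A₀ W u = W := if_pos hu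

theorem sectionPath_of_pos (hu : 0 < u) :
    sectionPath p A₀ W u = extendedSection p A₀ (p * min u 1 / 2) (p / min u 1) :=
  if_neg hu.not_ge

/-- The value depends neither on A₀ nor on W, so this is where the paths from two given sets meet.
-/
theorem sectionPath_one (hp : 0 < p) :
    sectionPath p A₀ W 1 =
      commonSection (translationSetoid p) dilationSetoid ∅ (annulus (p / 2))
        (Set.Ico p (p + p)) := by
  rw [sectionPath_of_pos one_pos, extendedSection]
  simp [trimmed_eq_empty hp]

theorem waveletSetDist_self (W : Set ℝ) : waveletSetDist W W = 0 := by
  simp [waveletSetDist]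

theorem sectionPath_spec (hp : 0 < p) (hm : NullMeasurableSet W)
    (ht : TilesByTranslation p W) (hd : TilesByDilation W) (hA : MeasurableSet A₀)
    (hAr : IsPartialSection (translationSetoid p) A₀) (hAs : IsPartialSection dilationSetoid A₀)
    (u : ℝ) : NullMeasurableSet (sectionPath p A₀ W u) ∧
      TilesByTranslation p (sectionPath p A₀ W u) ∧ TilesByDilation (sectionPath p A₀ W u) := by
  rcases le_or_gt u 0 with hu | hu
  · rw [sectionPath_of_nonpos hu]
    exact ⟨hm, ht, hd⟩
  · rw [sectionPath_of_pos hu]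
    have hmin : 0 < min u 1 := lt_min hu one_pos
    have hmin' : min u 1 ≤ 1 := min_le_right _ _
    refine ⟨(measurableSet_extendedSection hA).nullMeasurableSet,
      tilesByTranslation_extendedSection hp (by positivity) (by nlinarith) hAr,
      tilesByDilation_extendedSection (by positivity) (by positivity) ?_ hAs⟩
    rw [le_div_iff₀ hmin]
    nlinarith

theorem tendsto_sectionPath (hp : 0 < p)
    (ht : TilesByTranslation p W) (hd : TilesByDilation W) (hA : MeasurableSet A₀)
    (hAW : A₀ =ᵐ[volume] W)
    (hAr : IsPartialSection (translationSetoid p) A₀) (hAs : IsPartialSection dilationSetoid A₀)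
    (u₀ : ℝ) : Tendsto (fun u ↦ waveletSetDist (sectionPath p A₀ W u) (sectionPath p A₀ W u₀))
      (𝓝 u₀) (𝓝 0) := by
  have hmin : Tendsto (fun u : ℝ ↦ min u 1) (𝓝 u₀) (𝓝 (min u₀ 1)) :=
    (continuous_id.min continuous_const).tendsto u₀
  have hεt : Tendsto (fun u : ℝ ↦ p * min u 1 / 2) (𝓝 u₀) (𝓝 (p * min u₀ 1 / 2)) :=
    (hmin.const_mul p).div_const 2
  have hεp : ∀ u : ℝ, 0 < u → 0 < p * min u 1 / 2 ∧ 2 * (p * min u 1 / 2) ≤ p := by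
    intro u hu
    have h1 : 0 < min u 1 := lt_min hu one_pos
    have h2 : min u 1 ≤ 1 := min_le_right _ _
    exact ⟨by positivity, by nlinarith⟩
  rcases lt_trichotomy u₀ 0 with h | rfl | h
  · refine tendsto_const_nhds.congr' ?_
    filter_upwards [Iio_mem_nhds h] with u hu
    rw [sectionPath_of_nonpos h.le, sectionPath_of_nonpos (le_of_lt hu), waveletSetDist_self]
  · rw [sectionPath_of_nonpos le_rfl, ← nhdsLE_sup_nhdsGT, tendsto_sup]
    constructor
    · refine tendsto_const_nhds.congr' ?_
      filter_upwards [self_mem_nhdsWithin] with u hu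
      rw [sectionPath_of_nonpos hu, waveletSetDist_self]
    · have hmin0 : Tendsto (fun u : ℝ ↦ min u 1) (𝓝[>] 0) (𝓝[>] 0) := by
        refine tendsto_nhdsWithin_iff.2 ⟨?_, ?_⟩
        · simpa using hmin.mono_left nhdsWithin_le_nhds
        · filter_upwards [self_mem_nhdsWithin] with u hu
          exact lt_min (Set.mem_Ioi.1 hu) one_pos
      have h1 : Tendsto (fun u : ℝ ↦ p * min u 1 / 2) (𝓝[>] 0) (𝓝 0) := by
        simpa using hεt.mono_left nhdsWithin_le_nhds
      have h2 : Tendsto (fun u : ℝ ↦ p / min u 1) (𝓝[>] 0) atTop := by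
        simp_rw [div_eq_mul_inv]
        exact (tendsto_inv_nhdsGT_zero.comp hmin0).const_mul_atTop hp
      have h3 := tendsto_waveletSetDist_endpoint hp h1 h2
        (by filter_upwards [self_mem_nhdsWithin] with u hu using hεp u hu) ht hd hA hAW hAr hAs
      refine h3.congr' ?_
      filter_upwards [self_mem_nhdsWithin] with u hu
      rw [sectionPath_of_pos hu]
  · have hpos : 0 < min u₀ 1 := lt_min h one_pos
    rw [sectionPath_of_pos h]
    have hRt : Tendsto (fun u : ℝ ↦ p / min u 1) (𝓝 u₀) (𝓝 (p / min u₀ 1)) :=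
      tendsto_const_nhds.div hmin hpos.ne'
    have h3 := tendsto_waveletSetDist_extendedSection hp hεt hRt
      (hεp u₀ h).1 (by filter_upwards [Ioi_mem_nhds h] with u hu using hεp u hu) (hεp u₀ h).2
      (by rw [le_div_iff₀ hpos]; nlinarith [min_le_right u₀ 1]) hA hAr hAs
    refine h3.congr' ?_
    filter_upwards [Ioi_mem_nhds h] with u hu
    rw [sectionPath_of_pos hu]

end Path

/-- Any two sets that tile by translations and dilations are joined by a continuous path of such
sets. -/
theorem exists_path_of_tiles {p : ℝ} (hp : 0 < p) {W₀ W₁ : Set ℝ} (hm₀ : NullMeasurableSet W₀)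
    (ht₀ : TilesByTranslation p W₀) (hd₀ : TilesByDilation W₀) (hm₁ : NullMeasurableSet W₁)
    (ht₁ : TilesByTranslation p W₁) (hd₁ : TilesByDilation W₁) :
    ∃ W : unitInterval → Set ℝ, W 0 = W₀ ∧ W 1 = W₁ ∧
      (∀ t, NullMeasurableSet (W t) ∧ TilesByTranslation p (W t) ∧ TilesByDilation (W t)) ∧
        ∀ s, Tendsto (fun t ↦ waveletSetDist (W t) (W s)) (𝓝 s) (𝓝 0) := by
  obtain ⟨A₀, hA₀, hAW₀, hAr₀, hAs₀⟩ := exists_isPartialSection_ae_eq hm₀ ht₀ hd₀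
  obtain ⟨A₁, hA₁, hAW₁, hAr₁, hAs₁⟩ := exists_isPartialSection_ae_eq hm₁ ht₁ hd₁
  set P₀ := sectionPath p A₀ W₀ with hP₀
  set P₁ := sectionPath p A₁ W₁ with hP₁
  have hmid : P₀ 1 = P₁ 1 := by rw [hP₀, hP₁, sectionPath_one hp, sectionPath_one hp]
  -- Run the first path forward and the second backward, both at double speed.
  set W : ℝ → Set ℝ := fun t ↦ if t ≤ 1 / 2 then P₀ (2 * t) else P₁ (2 - 2 * t) with hW
  have hWl : ∀ t, t ≤ 1 / 2 → W t = P₀ (2 * t) := fun t h ↦ if_pos h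
  have hWr : ∀ t, 1 / 2 ≤ t → W t = P₁ (2 - 2 * t) := by
    intro t h
    rcases h.eq_or_lt with rfl | h
    · rw [hWl _ le_rfl]
      norm_num
      exact hmid
    · exact if_neg h.not_ge
  have hl : ∀ s, Tendsto (fun t ↦ waveletSetDist (P₀ (2 * t)) (P₀ (2 * s))) (𝓝 s) (𝓝 0) :=
    fun s ↦ (tendsto_sectionPath hp ht₀ hd₀ hA₀ hAW₀ hAr₀ hAs₀ (2 * s)).comp
      ((continuous_const_mul 2).tendsto s)
  have hr : ∀ s, Tendsto (fun t ↦ waveletSetDist (P₁ (2 - 2 * t)) (P₁ (2 - 2 * s))) (𝓝 s) (𝓝 0) :=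
    fun s ↦ (tendsto_sectionPath hp ht₁ hd₁ hA₁ hAW₁ hAr₁ hAs₁ (2 - 2 * s)).comp
      ((continuous_const.sub (continuous_const_mul 2)).tendsto s)
  have hcont : ∀ s, Tendsto (fun t ↦ waveletSetDist (W t) (W s)) (𝓝 s) (𝓝 0) := by
    intro s
    rcases lt_trichotomy s (1 / 2) with h | rfl | h
    · refine (hl s).congr' ?_
      filter_upwards [Iio_mem_nhds h] with t ht
      rw [hWl s h.le, hWl t (le_of_lt ht)]
    · rw [← nhdsLE_sup_nhdsGT, tendsto_sup]
      constructor
      · refine ((hl _).mono_left nhdsWithin_le_nhds).congr' ?_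
        filter_upwards [self_mem_nhdsWithin] with t ht
        rw [hWl _ le_rfl, hWl t ht]
      · refine ((hr _).mono_left nhdsWithin_le_nhds).congr' ?_
        filter_upwards [self_mem_nhdsWithin] with t ht
        rw [hWr _ le_rfl, hWr t (le_of_lt ht)]
    · refine (hr s).congr' ?_
      filter_upwards [Ioi_mem_nhds h] with t ht
      rw [hWr s h.le, hWr t (le_of_lt ht)]
  refine ⟨fun t ↦ W t, ?_, ?_, fun t ↦ ?_, fun s ↦ ?_⟩
  · change W 0 = W₀
    rw [hWl 0 (by norm_num)]
    exact sectionPath_of_nonpos (by norm_num)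
  · change W 1 = W₁
    rw [hWr 1 (by norm_num)]
    exact sectionPath_of_nonpos (by norm_num)
  · rcases le_total (t : ℝ) (1 / 2) with h | h
    · simp only [hWl t h]
      exact sectionPath_spec hp hm₀ ht₀ hd₀ hA₀ hAr₀ hAs₀ _
    · simp only [hWr t h]
      exact sectionPath_spec hp hm₁ ht₁ hd₁ hA₁ hAr₁ hAs₁ _
  · exact (hcont s).comp (continuous_subtype_val.tendsto s)

/-! ### The Fourier transform of dilated translates -/

section WeightedComp

variable {a b : ℝ} {m : ℝ → ℂ}

theorem map_affine_volume (ha : 0 < a) (b : ℝ) :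
    Measure.map (fun x : ℝ ↦ a * x - b) volume = ENNReal.ofReal a⁻¹ • volume := by
  have h : (fun x : ℝ ↦ a * x - b) = (fun x ↦ x - b) ∘ fun x ↦ a * x := rfl
  rw [h, ← Measure.map_map (measurable_sub_const b) (measurable_const_mul a),
    Real.map_volume_mul_left ha.ne', Measure.map_smul,
    (measurePreserving_sub_right volume b).map_eq, abs_of_pos (inv_pos.2 ha)]

theorem quasiMeasurePreserving_affine (ha : 0 < a) (b : ℝ) :
    Measure.QuasiMeasurePreserving (fun x : ℝ ↦ a * x - b) volume volume := by
  refine ⟨by fun_prop, ?_⟩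
  rw [map_affine_volume ha]
  exact Measure.smul_absolutelyContinuous

theorem eLpNorm_weightedComp (ha : 0 < a) (b : ℝ) (hn : ∀ x, ‖m x‖ = √a) {f : ℝ → ℂ}
    (hf : AEStronglyMeasurable f volume) :
    eLpNorm (fun x ↦ m x * f (a * x - b)) 2 volume = eLpNorm f 2 volume := by
  have hφ : AEMeasurable (fun x : ℝ ↦ a * x - b) volume := by fun_prop
  have h1 : eLpNorm (fun x ↦ m x * f (a * x - b)) 2 volume =
      eLpNorm ((√a : ℂ) • (f ∘ fun x ↦ a * x - b)) 2 volume := by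
    refine eLpNorm_congr_norm_ae (Eventually.of_forall fun x ↦ ?_)
    simp [hn, abs_of_nonneg (Real.sqrt_nonneg a)]
  have hf' : AEStronglyMeasurable f (Measure.map (fun x : ℝ ↦ a * x - b) volume) :=
    hf.mono_ac (quasiMeasurePreserving_affine ha b).absolutelyContinuous
  rw [h1, eLpNorm_const_smul, ← eLpNorm_map_measure hf' hφ, map_affine_volume ha,
    eLpNorm_smul_measure_of_ne_top (by simp), smul_eq_mul, ← mul_assoc]
  convert one_mul _
  have h2 : ‖(√a : ℂ)‖ₑ = ENNReal.ofReal (√a) := by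
    rw [← ofReal_norm]
    simp [abs_of_nonneg (Real.sqrt_nonneg a)]
  rw [h2, ENNReal.ofReal_rpow_of_pos (inv_pos.2 ha), ← ENNReal.ofReal_mul (Real.sqrt_nonneg a)]
  have h3 : (1 / (2 : ℝ≥0∞)).toReal = 1 / 2 := by simp
  rw [h3, ← Real.sqrt_eq_rpow, ← Real.sqrt_mul ha.le, mul_inv_cancel₀ ha.ne']
  simp

theorem memLp_weightedComp (ha : 0 < a) (b : ℝ) (hm : Measurable m) (hn : ∀ x, ‖m x‖ = √a)
    {f : ℝ → ℂ} (hf : MemLp f 2 volume) :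
    MemLp (fun x ↦ m x * f (a * x - b)) 2 volume := by
  refine ⟨?_, ?_⟩
  · exact hm.aestronglyMeasurable.mul
      (hf.1.comp_quasiMeasurePreserving (quasiMeasurePreserving_affine ha b))
  · rw [eLpNorm_weightedComp ha b hn hf.1]
    exact hf.2

/-- The isometry `f ↦ m · f(a · - b)` of `L²(ℝ)`, where `|m| = √a`. -/
def weightedComp (ha : 0 < a) (b : ℝ) (hm : Measurable m) (hn : ∀ x, ‖m x‖ = √a) :
    Lp ℂ 2 (volume : Measure ℝ) →ₗᵢ[ℂ] Lp ℂ 2 (volume : Measure ℝ) where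
  toFun f := (memLp_weightedComp ha b hm hn (Lp.memLp f)).toLp _
  map_add' f g := by
    rw [← MemLp.toLp_add, MemLp.toLp_eq_toLp_iff]
    filter_upwards [(quasiMeasurePreserving_affine ha b).ae (Lp.coeFn_add f g)] with x hx
    change m x * (f + g : Lp ℂ 2 (volume : Measure ℝ)) (a * x - b) = _
    rw [hx]
    exact mul_add _ _ _
  map_smul' c f := by
    rw [RingHom.id_apply, ← MemLp.toLp_const_smul, MemLp.toLp_eq_toLp_iff]
    filter_upwards [(quasiMeasurePreserving_affine ha b).ae (Lp.coeFn_smul c f)] with x hx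
    change m x * (c • f : Lp ℂ 2 (volume : Measure ℝ)) (a * x - b) = _
    rw [hx]
    exact mul_left_comm _ _ _
  norm_map' f := by
    change ‖(memLp_weightedComp ha b hm hn (Lp.memLp f)).toLp _‖ = ‖f‖
    rw [Lp.norm_toLp, eLpNorm_weightedComp ha b hn (Lp.memLp f).1, Lp.norm_def]

theorem coeFn_weightedComp (ha : 0 < a) (b : ℝ) (hm : Measurable m) (hn : ∀ x, ‖m x‖ = √a)
    (f : Lp ℂ 2 (volume : Measure ℝ)) :
    weightedComp ha b hm hn f =ᵐ[volume] fun x ↦ m x * f (a * x - b) :=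
  (memLp_weightedComp ha b hm hn (Lp.memLp f)).coeFn_toLp

end WeightedComp

theorem fourier_affine_comp {a : ℝ} (ha : 0 < a) (b : ℝ) (f : ℝ → ℂ) (ξ : ℝ) :
    𝓕 (fun x ↦ f (a * x - b)) ξ =
      (a⁻¹ : ℂ) * (Complex.exp (-(2 * Real.pi * (b / a) * ξ * Complex.I)) * 𝓕 f (a⁻¹ * ξ)) := by
  simp only [Real.fourier_real_eq_integral_exp_smul, smul_eq_mul]
  set G : ℝ → ℂ := fun u ↦ Complex.exp (↑(-2 * Real.pi * ((u + b) / a) * ξ) * Complex.I) * f u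
  have h1 : ∀ v : ℝ, Complex.exp (↑(-2 * Real.pi * v * ξ) * Complex.I) * f (a * v - b) =
      G (a * v - b) := by
    intro v
    simp only [G]
    congr 4
    field_simp
    ring
  simp_rw [h1]
  rw [Measure.integral_comp_mul_left (fun t ↦ G (t - b)) a, integral_sub_right_eq_self G b,
    abs_of_pos (inv_pos.2 ha), ← integral_const_mul]
  rw [Complex.real_smul, Complex.ofReal_inv]
  congr 2
  ext u
  simp only [G]
  rw [← mul_assoc, ← Complex.exp_add]
  congr 2
  push_cast
  field_simp
  ring

theorem exists_schwartzMap_affine_comp {a : ℝ} (ha : 0 < a) (b : ℝ) (c : ℂ) (f : SchwartzMap ℝ ℂ) :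
    ∃ g : SchwartzMap ℝ ℂ, ∀ x, g x = c * f (a * x - b) := by
  refine ⟨c • SchwartzMap.compCLMOfContinuousLinearEquiv ℂ
    (ContinuousLinearEquiv.smulLeft (Units.mk0 a ha.ne') : ℝ ≃L[ℝ] ℝ)
      (SchwartzMap.compSubConstCLM ℂ b f), fun x ↦ ?_⟩
  rw [_root_.smul_apply, smul_eq_mul]
  rfl

/-- Both sides are continuous in f, so it suffices to treat Schwartz functions, where the transform
is an integral and the change of variables applies. The multiplier m is tied to c only through
`hmc`, so that it can be supplied in simplified form. -/
theorem fourier_weightedComp {a : ℝ} (ha : 0 < a) (b : ℝ) {c : ℂ} (hc : ‖c‖ = √a) {m : ℝ → ℂ}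
    (hm : Measurable m) (hn : ∀ x, ‖m x‖ = √(a⁻¹))
    (hmc : ∀ x, m x = c * a⁻¹ * Complex.exp (-(2 * Real.pi * (b / a) * x * Complex.I)))
    (f : Lp ℂ 2 (volume : Measure ℝ)) :
    𝓕 (weightedComp ha b (measurable_const (a := c)) (fun _ ↦ hc) f) =
      weightedComp (inv_pos.2 ha) 0 hm hn (𝓕 f) := by
  refine DenseRange.induction_on (p := fun f ↦
    𝓕 (weightedComp ha b (measurable_const (a := c)) (fun _ ↦ hc) f) =
      weightedComp (inv_pos.2 ha) 0 hm hn (𝓕 f))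
    (SchwartzMap.denseRange_toLpCLM (F := ℂ) (p := 2) (μ := (volume : Measure ℝ))
      ENNReal.ofNat_ne_top) f ?_ ?_
  · refine isClosed_eq ?_ ?_
    · exact (Lp.fourierTransformₗᵢ ℝ ℂ).continuous.comp (LinearIsometry.continuous _)
    · exact (LinearIsometry.continuous _).comp (Lp.fourierTransformₗᵢ ℝ ℂ).continuous
  · intro f
    rw [SchwartzMap.toLpCLM_apply]
    have hT : ∀ f : SchwartzMap ℝ ℂ, ∀ᵐ x : ℝ, f.toLp 2 volume x = f x :=
      fun f ↦ f.coeFn_toLp 2 volume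
    obtain ⟨g, hg⟩ := exists_schwartzMap_affine_comp ha b c f
    have h1 : weightedComp ha b (measurable_const (a := c)) (fun _ ↦ hc) (f.toLp 2) =
        g.toLp 2 := by
      refine Lp.ext ?_
      filter_upwards [coeFn_weightedComp ha b (measurable_const (a := c)) (fun _ ↦ hc) (f.toLp 2),
        g.coeFn_toLp 2, (quasiMeasurePreserving_affine ha b).ae (hT f)] with x h1 h2 h3
      rw [h1, h2, h3, hg]
    rw [h1, SchwartzMap.toLp_fourier_eq, SchwartzMap.toLp_fourier_eq]
    refine Lp.ext ?_
    filter_upwards [coeFn_weightedComp (inv_pos.2 ha) 0 hm hn ((𝓕 f).toLp 2),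
      (𝓕 g).coeFn_toLp 2,
      (quasiMeasurePreserving_affine (inv_pos.2 ha) 0).ae (hT (𝓕 f))] with x h1 h2 h3
    rw [h1, h2, h3, SchwartzMap.fourier_coe, SchwartzMap.fourier_coe]
    have h4 : (g : ℝ → ℂ) = c • fun x ↦ f (a * x - b) := by
      ext x
      simp [hg]
    have h5 : 𝓕 (c • fun x ↦ f (a * x - b)) x = c * 𝓕 (fun x ↦ f (a * x - b)) x := by
      simp only [Real.fourier_real_eq_integral_exp_smul, smul_eq_mul, Pi.smul_apply,
        ← integral_const_mul]
      congr 1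
      ext v
      ring
    rw [h4, h5, fourier_affine_comp ha, hmc, sub_zero]
    push_cast
    ring

theorem two_rpow_half_eq_sqrt (j : ℤ) : (2 : ℝ) ^ ((j : ℝ) / 2) = √((2 : ℝ) ^ j) := by
  rw [Real.sqrt_eq_rpow, ← Real.rpow_intCast, ← Real.rpow_mul two_pos.le]
  congr 1
  ring

/-- The Fourier transform of `s ↦ 2^{j/2} w(2^j s - k)` in terms of that of `w`. -/
theorem exists_dilated_translate (w : Lp ℂ 2 (volume : Measure ℝ)) (j k : ℤ) :
    ∃ g : Lp ℂ 2 (volume : Measure ℝ),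
      (g =ᵐ[volume] fun s : ℝ ↦
        (((2 : ℝ) ^ ((j : ℝ) / 2) : ℝ) : ℂ) * w ((2 : ℝ) ^ j * s - (k : ℝ))) ∧
      ((𝓕 g : Lp ℂ 2 (volume : Measure ℝ)) =ᵐ[volume] fun ξ : ℝ ↦
        ((√((2 : ℝ) ^ (-j)) : ℝ) : ℂ) *
          Complex.exp (-(2 * Real.pi * k * ((2 : ℝ) ^ (-j) * ξ : ℝ) * Complex.I)) *
          (𝓕 w : Lp ℂ 2 (volume : Measure ℝ)) ((2 : ℝ) ^ (-j) * ξ)) := by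
  have ha : (0 : ℝ) < 2 ^ j := zpow_pos two_pos _
  set a : ℝ := 2 ^ j with hadef
  have hainv : (2 : ℝ) ^ (-j) = a⁻¹ := zpow_neg _ _
  have hc : ‖((√a : ℝ) : ℂ)‖ = √a := by simp [abs_of_nonneg (Real.sqrt_nonneg a)]
  set m : ℝ → ℂ := fun ξ ↦ ((√(a⁻¹) : ℝ) : ℂ) *
    Complex.exp (-(2 * Real.pi * k * (a⁻¹ * ξ : ℝ) * Complex.I)) with hm
  have hmm : Measurable m := by fun_prop
  have hn : ∀ x, ‖m x‖ = √(a⁻¹) := by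
    intro x
    rw [hm]
    have h1 : -(2 * Real.pi * k * (a⁻¹ * x : ℝ) * Complex.I) =
        ((-(2 * Real.pi * k * (a⁻¹ * x)) : ℝ) : ℂ) * Complex.I := by
      push_cast
      ring
    simp only [h1, norm_mul, Complex.norm_exp_ofReal_mul_I, mul_one, Complex.norm_real,
      Real.norm_eq_abs, abs_of_nonneg (Real.sqrt_nonneg _)]
  have hmc : ∀ x, m x = ((√a : ℝ) : ℂ) * a⁻¹ *
      Complex.exp (-(2 * Real.pi * ((k : ℝ) / a : ℂ) * x * Complex.I)) := by
    intro x
    simp only [hm]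
    congr 1
    · rw [← Complex.ofReal_mul]
      congr 1
      rw [Real.sqrt_inv]
      field_simp
      exact (Real.sq_sqrt ha.le).symm
    · congr 1
      push_cast
      field_simp
  refine ⟨weightedComp ha k (measurable_const (a := ((√a : ℝ) : ℂ))) (fun _ ↦ hc) w, ?_, ?_⟩
  · filter_upwards [coeFn_weightedComp ha k (measurable_const (a := ((√a : ℝ) : ℂ)))
      (fun _ ↦ hc) w] with s hs
    rw [hs, two_rpow_half_eq_sqrt]
  · rw [fourier_weightedComp ha k hc hmm hn hmc, hainv]
    filter_upwards [coeFn_weightedComp (inv_pos.2 ha) 0 hmm hn (𝓕 w)] with s hs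
    rw [hs, sub_zero]

/-! ### Completeness of the exponentials on a set tiling by integer translations -/

/-- The exponential `x ↦ exp (2π i k x)`. -/
def expChar (k : ℤ) (x : ℝ) : ℂ := Complex.exp (2 * Real.pi * k * x * Complex.I)

theorem continuous_expChar (k : ℤ) : Continuous (expChar k) := by
  unfold expChar
  fun_prop

theorem expChar_add_int (k n : ℤ) (x : ℝ) : expChar k (x + n) = expChar k x := by
  unfold expChar
  rw [show (2 * Real.pi * k * ((x + n : ℝ) : ℂ) * Complex.I : ℂ) =
    2 * Real.pi * k * x * Complex.I + ((k * n : ℤ) : ℂ) * (2 * Real.pi * Complex.I) by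
      push_cast; ring, Complex.exp_add, Complex.exp_int_mul_two_pi_mul_I, mul_one]

theorem norm_expChar (k : ℤ) (x : ℝ) : ‖expChar k x‖ = 1 := by
  rw [expChar, show (2 * Real.pi * k * x * Complex.I : ℂ) =
    ((2 * Real.pi * k * x : ℝ) : ℂ) * Complex.I by push_cast; ring,
    Complex.norm_exp_ofReal_mul_I]

theorem expChar_zero (x : ℝ) : expChar 0 x = 1 := by simp [expChar]

theorem expChar_mul (k l : ℤ) (x : ℝ) : expChar k x * expChar l x = expChar (k + l) x := by
  rw [expChar, expChar, expChar, ← Complex.exp_add]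
  congr 1
  push_cast
  ring

theorem conj_expChar (k : ℤ) (x : ℝ) : (starRingEnd ℂ) (expChar k x) = expChar (-k) x := by
  rw [expChar, expChar, ← Complex.exp_conj]
  congr 1
  simp only [map_mul, Complex.conj_ofReal, Complex.conj_I, map_ofNat, map_intCast]
  push_cast
  ring

theorem intervalIntegral_expChar {k : ℤ} (hk : k ≠ 0) : ∫ x in (0 : ℝ)..1, expChar k x = 0 := by
  have hc : (2 * Real.pi * k * Complex.I : ℂ) ≠ 0 := by
    simp [Real.pi_ne_zero, hk]
  have h : ∀ x : ℝ, expChar k x = Complex.exp ((2 * Real.pi * k * Complex.I) * x) := by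
    intro x
    rw [expChar]
    congr 1
    ring
  simp_rw [h]
  rw [integral_exp_mul_complex hc]
  have : Complex.exp (2 * Real.pi * k * Complex.I * (1 : ℝ)) = 1 := by
    rw [← Complex.exp_int_mul_two_pi_mul_I k]
    congr 1
    push_cast
    ring
  rw [this]
  simp

/-- Parseval on the circle: all Fourier coefficients vanish, hence so does the L² norm. -/
theorem ae_eq_zero_of_intervalIntegral_expChar {h : ℝ → ℂ}
    (hL2 : MemLp h 2 (volume.restrict (Set.Ioc 0 1)))
    (h0 : ∀ k : ℤ, ∫ x in Set.Ioc (0 : ℝ) 1, expChar k x * h x = 0) :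
    ∀ᵐ x ∂volume.restrict (Set.Ioc (0 : ℝ) 1), h x = 0 := by
  have hcoef : ∀ n, fourierCoeffOn (zero_lt_one' ℝ) h n = 0 := by
    intro n
    rw [fourierCoeffOn_eq_integral, intervalIntegral.integral_of_le zero_le_one]
    have : ∀ x : ℝ, fourier (-n) (x : AddCircle ((1 : ℝ) - 0)) • h x = expChar (-n) x * h x := by
      intro x
      rw [fourier_coe_apply, expChar, smul_eq_mul]
      congr 2
      push_cast
      ring
    simp_rw [this, h0, smul_zero]
  have hpars := tsum_sq_fourierCoeffOn (zero_lt_one' ℝ) hL2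
  simp only [hcoef, norm_zero, ne_eq, OfNat.ofNat_ne_zero, not_false_eq_true, zero_pow, tsum_zero,
    sub_zero, inv_one, one_smul] at hpars
  rw [intervalIntegral.integral_of_le zero_le_one] at hpars
  have hintegrable : Integrable (fun x ↦ ‖h x‖ ^ 2) (volume.restrict (Set.Ioc (0 : ℝ) 1)) :=
    (memLp_two_iff_integrable_sq_norm hL2.1).1 hL2
  have := (integral_eq_zero_iff_of_nonneg (fun x ↦ by positivity) hintegrable).1 hpars.symm
  filter_upwards [this] with x hx
  simpa using hx

theorem TilesByTranslation.isAddFundamentalDomain {D : Set ℝ} (hD : TilesByTranslation 1 D)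
    (hm : NullMeasurableSet D) :
    IsAddFundamentalDomain (AddSubgroup.zmultiples (1 : ℝ)) D volume := by
  refine IsAddFundamentalDomain.mk'' hm ?_ ?_ ?_
  · filter_upwards [hD] with x hx
    obtain ⟨k, hk, -⟩ := hx
    refine ⟨⟨k, ⟨k, by simp⟩⟩, ?_⟩
    simpa [AddSubgroup.vadd_def, add_comm] using hk
  · rintro ⟨_, k, rfl⟩ hg
    refine measure_mono_null (t := {x | ¬ ∃! k : ℤ, x + k * 1 ∈ D}) ?_ hD
    rintro x ⟨hx1, hx2⟩ hx
    rw [Set.mem_vadd_set_iff_neg_vadd_mem] at hx1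
    have h1 : x + ((-k : ℤ) : ℝ) * 1 ∈ D := by
      simpa [AddSubgroup.vadd_def, add_comm] using hx1
    have h2 : x + ((0 : ℤ) : ℝ) * 1 ∈ D := by simpa using hx2
    have h3 := hx.unique h1 h2
    apply hg
    ext
    simp at h3
    simp [h3]
  · intro g
    exact (measurePreserving_vadd g volume).quasiMeasurePreserving

theorem isAddFundamentalDomain_Ioc_one :
    IsAddFundamentalDomain (AddSubgroup.zmultiples (1 : ℝ)) (Set.Ioc (0 : ℝ) 1) volume := by
  simpa using isAddFundamentalDomain_Ioc one_pos (0 : ℝ) volume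

theorem periodic_vadd {β : Type*} {f : ℝ → β} (hf : ∀ (x : ℝ) (n : ℤ), f (x + n) = f x)
    (g : AddSubgroup.zmultiples (1 : ℝ)) (x : ℝ) : f (g +ᵥ x) = f x := by
  obtain ⟨_, k, rfl⟩ := g
  simpa [AddSubgroup.vadd_def, add_comm] using hf x k

variable {D : Set ℝ}

theorem setIntegral_expChar (hD : TilesByTranslation 1 D) (hm : NullMeasurableSet D) (k : ℤ) :
    ∫ x in D, expChar k x = if k = 0 then 1 else 0 := by
  rw [(hD.isAddFundamentalDomain hm).setIntegral_eq isAddFundamentalDomain_Ioc_one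
    (periodic_vadd fun x n ↦ expChar_add_int k n x)]
  split_ifs with hk
  · subst hk
    simp [expChar_zero]
  · rw [← intervalIntegral.integral_of_le zero_le_one, intervalIntegral_expChar hk]

/-- A square integrable function on a set tiling by integer translations vanishes if it is
orthogonal to all exponentials. -/
theorem ae_eq_zero_of_setIntegral_expChar (hD : TilesByTranslation 1 D)
    (hm : NullMeasurableSet D) {G : ℝ → ℂ} (hG : MemLp G 2 (volume.restrict D))
    (h0 : ∀ k : ℤ, ∫ x in D, expChar k x * G x = 0) :
    ∀ᵐ x ∂volume.restrict D, G x = 0 := by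
  have hfd := hD.isAddFundamentalDomain hm
  have hfi := isAddFundamentalDomain_Ioc_one
  -- Periodize G restricted to D. On D a single term survives, so h = G there almost everywhere, and
  -- periodicity moves norms and integrals between the fundamental domains D and (0, 1].
  set h : ℝ → ℂ := fun x ↦ ∑' n : ℤ, D.indicator G (x + n) with hh
  have hper : ∀ (x : ℝ) (n : ℤ), h (x + n) = h x := by
    intro x n
    simp only [hh]
    rw [← (Equiv.addLeft n).tsum_eq fun l : ℤ ↦ D.indicator G (x + l)]
    congr 1
    ext l
    simp [add_assoc]
  have hhG : ∀ᵐ x ∂volume.restrict D, h x = G x := by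
    rw [ae_restrict_iff'₀ hm]
    filter_upwards [hD] with x hx hxD
    simp only [hh]
    rw [tsum_eq_single 0]
    · simp [hxD]
    · intro n hn
      refine Set.indicator_of_notMem (fun hmem ↦ hn ?_) _
      exact hx.unique (by simpa using hmem) (by simpa using hxD)
  have hhD : MemLp h 2 (volume.restrict D) := (memLp_congr_ae hhG).2 hG
  have hmeas : AEStronglyMeasurable h (volume.restrict (Set.Ioc (0 : ℝ) 1)) :=
    (hfd.aestronglyMeasurable_on_iff hfi (periodic_vadd hper)).1 hhD.1
  have hnorm : eLpNorm h 2 (volume.restrict (Set.Ioc (0 : ℝ) 1)) =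
      eLpNorm h 2 (volume.restrict D) := by
    rw [eLpNorm_eq_lintegral_rpow_enorm_toReal (by simp) (by simp),
      eLpNorm_eq_lintegral_rpow_enorm_toReal (by simp) (by simp)]
    congr 1
    exact hfi.setLIntegral_eq hfd _ fun g x ↦ by rw [periodic_vadd hper]
  have hhI : MemLp h 2 (volume.restrict (Set.Ioc (0 : ℝ) 1)) := ⟨hmeas, hnorm ▸ hhD.2⟩
  have hcoef : ∀ k : ℤ, ∫ x in Set.Ioc (0 : ℝ) 1, expChar k x * h x = 0 := by
    intro k
    rw [← h0 k, hfi.setIntegral_eq hfd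
      (periodic_vadd fun x n ↦ by rw [hper, expChar_add_int])]
    refine integral_congr_ae ?_
    filter_upwards [hhG] with x hx
    rw [hx]
  have hzero := ae_eq_zero_of_intervalIntegral_expChar hhI hcoef
  have hDzero : eLpNorm h 2 (volume.restrict D) = 0 := by
    rw [← hnorm]
    exact (eLpNorm_eq_zero_iff hmeas (by simp)).2 hzero
  filter_upwards [(eLpNorm_eq_zero_iff hhD.1 (by simp)).1 hDzero, hhG] with x hx hx'
  rw [← hx', hx]
  rfl

/-! ### Wavelets whose Fourier transform is a multiple of an indicator function -/

/-- The Fourier transform of `s ↦ 2^{j/2} w(2^j s - k)` when that of `w` is `c` times the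
indicator function of `V`. -/
def freqAtom (V : Set ℝ) (c : ℂ) (j k : ℤ) (ξ : ℝ) : ℂ :=
  ((√((2 : ℝ) ^ (-j)) : ℝ) : ℂ) * expChar (-k) ((2 : ℝ) ^ (-j) * ξ) *
    V.indicator (fun _ ↦ c) ((2 : ℝ) ^ (-j) * ξ)

variable {V : Set ℝ} {c : ℂ} {w : Lp ℂ 2 (volume : Measure ℝ)}

theorem exists_dilated_translate_freqAtom
    (hw : (𝓕 w : Lp ℂ 2 (volume : Measure ℝ)) =ᵐ[volume] V.indicator fun _ ↦ c) (j k : ℤ) :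
    ∃ g : Lp ℂ 2 (volume : Measure ℝ),
      (g =ᵐ[volume] fun s : ℝ ↦
        (((2 : ℝ) ^ ((j : ℝ) / 2) : ℝ) : ℂ) * w ((2 : ℝ) ^ j * s - (k : ℝ))) ∧
      (𝓕 g : Lp ℂ 2 (volume : Measure ℝ)) =ᵐ[volume] freqAtom V c j k := by
  obtain ⟨g, hg, hg'⟩ := exists_dilated_translate w j k
  refine ⟨g, hg, ?_⟩
  filter_upwards [hg', (quasiMeasurePreserving_dilation (-j)).ae hw] with ξ h1 h2
  rw [h1, h2, freqAtom, expChar]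
  congr 3
  push_cast
  ring

theorem inner_freqAtom (hV : MeasurableSet V) {j k : ℤ} {E F : Lp ℂ 2 (volume : Measure ℝ)}
    (hE : E =ᵐ[volume] freqAtom V c j k) :
    inner ℂ E F = ((√((2 : ℝ) ^ j) : ℝ) : ℂ) * (starRingEnd ℂ) c *
      ∫ η in V, expChar k η * F ((2 : ℝ) ^ j * η) := by
  have ha : (0 : ℝ) < 2 ^ j := zpow_pos two_pos _
  rw [L2.inner_def]
  set a : ℝ := 2 ^ j with hadef
  have hainv : (2 : ℝ) ^ (-j) = a⁻¹ := zpow_neg _ _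
  set H : ℝ → ℂ := fun η ↦ ((√(a⁻¹) : ℝ) : ℂ) * (starRingEnd ℂ) c *
    V.indicator (fun η ↦ expChar k η * F (a * η)) η with hH
  have h1 : ∀ᵐ ξ : ℝ, inner ℂ (E ξ) (F ξ) = H (a⁻¹ * ξ) := by
    filter_upwards [hE] with ξ hξ
    rw [hξ, RCLike.inner_apply, freqAtom, hainv, hH]
    simp only [map_mul, Complex.conj_ofReal, conj_expChar, neg_neg]
    by_cases hmem : a⁻¹ * ξ ∈ V
    · simp only [Set.indicator_of_mem hmem, mul_inv_cancel_left₀ ha.ne']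
      ring
    · simp only [Set.indicator_of_notMem hmem, map_zero, mul_zero]
  rw [integral_congr_ae h1, Measure.integral_comp_mul_left H a⁻¹, inv_inv, abs_of_pos ha, hH,
    integral_const_mul, integral_indicator hV, Complex.real_smul, ← mul_assoc, ← mul_assoc,
    ← Complex.ofReal_mul]
  -- The Jacobian 2^j of ξ = 2^j η combines with √(2^{-j}) to give √(2^j).
  congr 3
  rw [Real.sqrt_inv]
  nth_rewrite 1 [← Real.mul_self_sqrt ha.le]
  rw [mul_assoc, mul_inv_cancel₀ (Real.sqrt_pos.2 ha).ne', mul_one]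

/-! ### Tiling sets give orthonormal wavelets -/

section Sufficiency

theorem setIntegral_freqAtom_of_ne (hd : TilesByDilation V) (hV : MeasurableSet V) {j j' : ℤ}
    (hj : j ≠ j') (k k' : ℤ) :
    ∫ η in V, expChar k η * freqAtom V c j' k' ((2 : ℝ) ^ j * η) = 0 := by
  refine integral_eq_zero_of_ae ?_
  refine (ae_restrict_iff' hV).2 ?_
  filter_upwards [hd] with η hη hηV
  have hmem : (2 : ℝ) ^ (-j') * ((2 : ℝ) ^ j * η) ∉ V := by
    intro h
    rw [← mul_assoc, ← zpow_add₀ two_ne_zero] at h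
    have := hη.unique h (show (2 : ℝ) ^ (0 : ℤ) * η ∈ V by simpa using hηV)
    exact hj (by lia)
  rw [freqAtom, Set.indicator_of_notMem hmem, mul_zero, mul_zero, Pi.zero_apply]

theorem setIntegral_freqAtom_self (ht : TilesByTranslation 1 V) (hV : MeasurableSet V)
    (j k k' : ℤ) :
    ∫ η in V, expChar k η * freqAtom V c j k' ((2 : ℝ) ^ j * η) =
      ((√((2 : ℝ) ^ (-j)) : ℝ) : ℂ) * c * if k = k' then 1 else 0 := by
  have h1 : ∀ η ∈ V, expChar k η * freqAtom V c j k' ((2 : ℝ) ^ j * η) =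
      ((√((2 : ℝ) ^ (-j)) : ℝ) : ℂ) * c * expChar (k - k') η := by
    intro η hη
    have h2 : (2 : ℝ) ^ (-j) * ((2 : ℝ) ^ j * η) = η := by
      rw [← mul_assoc, ← zpow_add₀ two_ne_zero]
      simp
    rw [freqAtom, h2, Set.indicator_of_mem hη, sub_eq_add_neg, ← expChar_mul]
    ring
  rw [setIntegral_congr_fun hV h1, integral_const_mul,
    setIntegral_expChar ht hV.nullMeasurableSet]
  simp only [sub_eq_zero]

/-- On the Fourier side, different scales have disjoint supports by the dilation tiling, and within
one scale the exponentials are orthonormal on V by the translation tiling. If f is orthogonal to all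
atoms, completeness of the exponentials makes its transform vanish on every dilate of V, and the
dilates cover the line. -/
theorem isOrthonormalWavelet_of_tiles (hV : MeasurableSet V) (ht : TilesByTranslation 1 V)
    (hd : TilesByDilation V)
    (hw : (𝓕 w : Lp ℂ 2 (volume : Measure ℝ)) =ᵐ[volume] V.indicator fun _ ↦ (1 : ℂ)) :
    IsOrthonormalWavelet w := by
  choose g hg hg' using fun i : ℤ × ℤ ↦ exists_dilated_translate_freqAtom hw i.1 i.2
  have horth : Orthonormal ℂ g := by
    rw [orthonormal_iff_ite]
    rintro ⟨j, k⟩ ⟨j', k'⟩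
    rw [← Lp.inner_fourier_eq, inner_freqAtom hV (hg' (j, k))]
    have hcongr : ∫ η in V, expChar k η *
        (𝓕 (g (j', k')) : Lp ℂ 2 (volume : Measure ℝ)) ((2 : ℝ) ^ j * η) =
        ∫ η in V, expChar k η * freqAtom V 1 j' k' ((2 : ℝ) ^ j * η) := by
      refine integral_congr_ae (ae_restrict_of_ae ?_)
      filter_upwards [(quasiMeasurePreserving_dilation j).ae (hg' (j', k'))] with η hη
      rw [hη]
    rw [hcongr]
    by_cases hj : j = j'
    · subst hj
      rw [setIntegral_freqAtom_self ht hV]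
      have : ((√((2 : ℝ) ^ j) : ℝ) : ℂ) * ((√((2 : ℝ) ^ (-j)) : ℝ) : ℂ) = 1 := by
        rw [← Complex.ofReal_mul, zpow_neg, Real.sqrt_inv, mul_inv_cancel₀, Complex.ofReal_one]
        exact (Real.sqrt_pos.2 (zpow_pos two_pos _)).ne'
      simp only [map_one, mul_one, ← mul_assoc, this, one_mul, Prod.mk.injEq, true_and]
    · rw [setIntegral_freqAtom_of_ne hd hV hj]
      simp [hj]
  have hcomp : (Submodule.span ℂ (Set.range g))ᗮ = ⊥ := by
    rw [Submodule.eq_bot_iff]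
    intro f hf
    set F : Lp ℂ 2 (volume : Measure ℝ) := 𝓕 f with hF
    have hzero : ∀ j : ℤ, ∀ᵐ η : ℝ, η ∈ V → F ((2 : ℝ) ^ j * η) = 0 := by
      intro j
      rw [← ae_restrict_iff' hV]
      have hc0 : (0 : ℝ) < 2 ^ j := zpow_pos two_pos _
      have hmem : MemLp (fun η ↦ F ((2 : ℝ) ^ j * η)) 2 volume := by
        have h1 := (memLp_weightedComp hc0 0 (m := fun _ ↦ ((√((2 : ℝ) ^ j) : ℝ) : ℂ))
          measurable_const (fun _ ↦ by simp [abs_of_nonneg (Real.sqrt_nonneg _)])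
          (Lp.memLp F)).const_mul (((√((2 : ℝ) ^ j) : ℝ) : ℂ)⁻¹)
        refine (memLp_congr_ae (Eventually.of_forall fun η ↦ ?_)).1 h1
        have h2 : ((√((2 : ℝ) ^ j) : ℝ) : ℂ) ≠ 0 :=
          Complex.ofReal_ne_zero.2 (Real.sqrt_pos.2 hc0).ne'
        simp only [sub_zero]
        rw [inv_mul_cancel_left₀ h2]
      refine ae_eq_zero_of_setIntegral_expChar ht hV.nullMeasurableSet (hmem.restrict V) fun k ↦ ?_
      have h3 : inner ℂ (g (j, k)) f = 0 :=
        (Submodule.mem_orthogonal _ _).1 hf _ (Submodule.subset_span ⟨(j, k), rfl⟩)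
      rw [← Lp.inner_fourier_eq, inner_freqAtom hV (hg' (j, k))] at h3
      have h2 : ((√((2 : ℝ) ^ j) : ℝ) : ℂ) ≠ 0 :=
        Complex.ofReal_ne_zero.2 (Real.sqrt_pos.2 hc0).ne'
      simpa [h2] using h3
    have hFz : F = 0 := by
      refine Lp.ext ?_
      have h4 : ∀ᵐ x : ℝ, ∀ i j : ℤ, (2 : ℝ) ^ i * x ∈ V →
          F ((2 : ℝ) ^ j * ((2 : ℝ) ^ i * x)) = 0 :=
        ae_all_iff.2 fun i ↦ ae_all_iff.2 fun j ↦ (quasiMeasurePreserving_dilation i).ae (hzero j)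
      filter_upwards [h4, hd, Lp.coeFn_zero ℂ 2 (volume : Measure ℝ)] with x hx hx' h0
      obtain ⟨i, hi, -⟩ := hx'
      have := hx i (-i) hi
      rw [← mul_assoc, ← zpow_add₀ two_ne_zero] at this
      rw [h0]
      simpa using this
    have hinj := (Lp.fourierTransformₗᵢ ℝ ℂ).injective
    exact hinj (hFz.trans (map_zero (Lp.fourierTransformₗᵢ ℝ ℂ)).symm)
  refine ⟨HilbertBasis.mkOfOrthogonalEqBot horth hcomp, fun j k ↦ ?_⟩
  rw [HilbertBasis.coe_mkOfOrthogonalEqBot]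
  exact hg (j, k)

end Sufficiency

/-! ### Orthonormal wavelets come only from tiling sets -/

section Necessity

variable {V : Set ℝ}

/-- The integral in `hdisj` is the measure of the overlap of V with its preimage under dilation by
2^j. For covering, a function supported off all dilates of V is orthogonal to every atom, hence
zero; truncating to [-n, n] makes the indicator square integrable. -/
theorem tilesByDilation_of_complete (hV : MeasurableSet V) (hfin : volume V ≠ ∞)
    (hdisj : ∀ j : ℤ, j ≠ 0 → ∫ η in V, V.indicator (fun _ ↦ (1 : ℂ)) ((2 : ℝ) ^ j * η) = 0)
    (hcomp : ∀ F : ℝ → ℂ, MemLp F 2 volume →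
      (∀ j k : ℤ, ∫ η in V, expChar k η * F ((2 : ℝ) ^ j * η) = 0) → F =ᵐ[volume] 0) :
    TilesByDilation V := by
  have hmeas : ∀ j : ℤ, MeasurableSet ((fun x ↦ (2 : ℝ) ^ j * x) ⁻¹' V) :=
    fun j ↦ (measurable_const_mul _) hV
  have h1 : ∀ j : ℤ, j ≠ 0 → ∀ᵐ η : ℝ, ¬ (η ∈ V ∧ (2 : ℝ) ^ j * η ∈ V) := by
    intro j hj
    have h2 : ∫ η in V, V.indicator (fun _ ↦ (1 : ℂ)) ((2 : ℝ) ^ j * η) =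
        ∫ η in V, ((fun x ↦ (2 : ℝ) ^ j * x) ⁻¹' V).indicator (fun _ ↦ (1 : ℂ)) η := rfl
    have h3 := hdisj j hj
    rw [h2, integral_indicator (hmeas j), Measure.restrict_restrict (hmeas j)] at h3
    simp only [integral_const, measureReal_restrict_apply_univ, Complex.real_smul,
      mul_one, Complex.ofReal_eq_zero] at h3
    have hfin' : volume ((fun x ↦ (2 : ℝ) ^ j * x) ⁻¹' V ∩ V) ≠ ∞ :=
      ne_top_of_le_ne_top hfin (measure_mono Set.inter_subset_right)
    rw [measureReal_eq_zero_iff hfin', measure_eq_zero_iff_ae_notMem] at h3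
    filter_upwards [h3] with η hη h
    exact hη ⟨h.2, h.1⟩
  have h2 : ∀ᵐ x : ℝ, ∀ i j : ℤ, j ≠ 0 →
      ¬ ((2 : ℝ) ^ i * x ∈ V ∧ (2 : ℝ) ^ j * ((2 : ℝ) ^ i * x) ∈ V) := by
    refine ae_all_iff.2 fun i ↦ ae_all_iff.2 fun j ↦ ?_
    by_cases hj : j = 0
    · simp [hj]
    · filter_upwards [(quasiMeasurePreserving_dilation i).ae (h1 j hj)] with x hx _
      exact hx
  have h3 : ∀ᵐ x : ℝ, x ∈ sat dilationSetoid V := by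
    have hN : MeasurableSet (sat dilationSetoid V)ᶜ := (measurableSet_sat_dilation hV).compl
    have h4 : ∀ n : ℕ, ∀ᵐ x : ℝ, x ∉ (sat dilationSetoid V)ᶜ ∩ Set.Icc (-n : ℝ) n := by
      intro n
      set B := (sat dilationSetoid V)ᶜ ∩ Set.Icc (-n : ℝ) n
      have hB : MeasurableSet B := hN.inter measurableSet_Icc
      have hBfin : volume B ≠ ∞ :=
        ne_top_of_le_ne_top (by simp) (measure_mono (Set.inter_subset_right))
      have := hcomp (B.indicator fun _ ↦ 1) (memLp_indicator_const 2 hB 1 (Or.inr hBfin)) ?_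
      · filter_upwards [this] with x hx hxB
        simp [Set.indicator_of_mem hxB] at hx
      · intro j k
        refine integral_eq_zero_of_ae ((ae_restrict_iff' hV).2 (Eventually.of_forall ?_))
        intro η hη
        have hmem : (2 : ℝ) ^ j * η ∉ B := by
          intro h
          refine h.1 (mem_sat_dilation.2 ⟨-j, ?_⟩)
          rw [← mul_assoc, ← zpow_add₀ two_ne_zero]
          simpa using hη
        simp only [Set.indicator_of_notMem hmem, mul_zero, Pi.zero_apply]
    filter_upwards [ae_all_iff.2 h4] with x hx
    obtain ⟨n, hn⟩ := exists_nat_ge |x|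
    by_contra h
    exact hx n ⟨h, abs_le.1 hn⟩
  filter_upwards [h2, h3] with x hx hx'
  obtain ⟨i, hi⟩ := mem_sat_dilation.1 hx'
  refine ⟨i, hi, fun j hj ↦ ?_⟩
  by_contra hne
  refine hx i (j - i) (sub_ne_zero.2 hne) ⟨hi, ?_⟩
  rw [← mul_assoc, ← zpow_add₀ two_ne_zero, sub_add_cancel]
  exact hj

/-- If B and B + n both lie in V, then 1_B - 1_{B+n} is orthogonal to the exponentials at scale 0 by
periodicity and to the other scales by disjointness. Completeness makes it zero, so B is null.
Cutting by [m, m + 1) makes B of finite measure and disjoint from B + n. -/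
theorem ae_translation_unique_of_complete (hV : MeasurableSet V) (hd : TilesByDilation V)
    (hcomp : ∀ F : ℝ → ℂ, MemLp F 2 volume →
      (∀ j k : ℤ, ∫ η in V, expChar k η * F ((2 : ℝ) ^ j * η) = 0) → F =ᵐ[volume] 0) :
    ∀ᵐ x : ℝ, ∀ k l : ℤ, x + k * 1 ∈ V → x + l * 1 ∈ V → k = l := by
  have h1 : ∀ n m : ℤ, n ≠ 0 → ∀ᵐ x : ℝ, ¬ ((x ∈ V ∧ x + n ∈ V) ∧ x ∈ Set.Ico (m : ℝ) (m + 1)) := by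
    intro n m hn
    set B : Set ℝ := (V ∩ (fun x ↦ x + n) ⁻¹' V) ∩ Set.Ico (m : ℝ) (m + 1)
    set B' : Set ℝ := (fun x ↦ x - n) ⁻¹' B
    have hB : MeasurableSet B :=
      (hV.inter ((measurable_add_const _) hV)).inter measurableSet_Ico
    have hB' : MeasurableSet B' := (measurable_sub_const _) hB
    have hBfin : volume B ≠ ∞ :=
      ne_top_of_le_ne_top (by simp) (measure_mono (Set.inter_subset_right))
    have hB'fin : volume B' ≠ ∞ := by
      rwa [(measurePreserving_sub_right volume (n : ℝ)).measure_preimage hB.nullMeasurableSet]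
    have hBV : B ⊆ V := fun x hx ↦ hx.1.1
    have hB'V : B' ⊆ V := fun x hx ↦ by simpa using hx.1.2
    have hBB' : ∀ x ∈ B, x ∉ B' := by
      intro x hx hx'
      have h2 := hx.2
      have h3 : x - n ∈ Set.Ico (m : ℝ) (m + 1) := hx'.2
      have h4 : (n : ℝ) < 1 := by linarith [h2.2, h3.1]
      have h5 : (-1 : ℝ) < n := by linarith [h2.1, h3.2]
      have h4' : n < 1 := by exact_mod_cast h4
      have h5' : -1 < n := by exact_mod_cast h5
      exact hn (by lia)
    have hz := hcomp (fun x ↦ B.indicator (fun _ ↦ (1 : ℂ)) x - B'.indicator (fun _ ↦ (1 : ℂ)) x)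
      ((memLp_indicator_const 2 hB 1 (Or.inr hBfin)).sub
        (memLp_indicator_const 2 hB' 1 (Or.inr hB'fin))) ?_
    · filter_upwards [hz] with x hx hxB
      have hxB' : x ∈ B := hxB
      simp [Set.indicator_of_mem hxB', Set.indicator_of_notMem (hBB' x hxB')] at hx
    · intro j k
      by_cases hj : j = 0
      · subst hj
        simp only [zpow_zero, one_mul, mul_sub]
        have hind : ∀ S : Set ℝ, ∀ η, expChar k η * S.indicator (fun _ ↦ (1 : ℂ)) η =
            S.indicator (expChar k) η := by
          intro S η
          by_cases h : η ∈ S <;> simp [h]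
        simp only [hind]
        have hintegrable : ∀ S : Set ℝ, MeasurableSet S → volume S ≠ ∞ →
            IntegrableOn (expChar k) S volume := by
          intro S hS hSfin
          refine IntegrableOn.of_bound hSfin.lt_top
            (continuous_expChar k).aestronglyMeasurable 1 (Eventually.of_forall fun x ↦ ?_)
          rw [norm_expChar]
        rw [integral_sub ((integrable_indicator_iff hB).2 (hintegrable B hB hBfin)).restrict
          ((integrable_indicator_iff hB').2 (hintegrable B' hB' hB'fin)).restrict,
          setIntegral_indicator hB, setIntegral_indicator hB', Set.inter_eq_right.2 hBV,
          Set.inter_eq_right.2 hB'V, sub_eq_zero]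
        rw [← (measurePreserving_sub_right volume (n : ℝ)).setIntegral_preimage_emb
          (MeasurableEquiv.subRight (n : ℝ)).measurableEmbedding (expChar k) B]
        refine setIntegral_congr_fun hB' fun x _ ↦ ?_
        have := expChar_add_int k (-n) x
        rw [← this]
        simp [sub_eq_add_neg]
      · refine integral_eq_zero_of_ae ((ae_restrict_iff' hV).2 ?_)
        filter_upwards [hd] with η hη hηV
        have hmem : (2 : ℝ) ^ j * η ∉ V := fun h ↦
          hj (hη.unique h (show (2 : ℝ) ^ (0 : ℤ) * η ∈ V by simpa using hηV))
        simp only [Set.indicator_of_notMem fun h ↦ hmem (hBV h),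
          Set.indicator_of_notMem fun h ↦ hmem (hB'V h), sub_zero, mul_zero, Pi.zero_apply]
  have h2 : ∀ᵐ x : ℝ, ∀ k n : ℤ, n ≠ 0 → ¬ (x + k * 1 ∈ V ∧ x + k * 1 + n ∈ V) := by
    refine ae_all_iff.2 fun k ↦ ae_all_iff.2 fun n ↦ ?_
    by_cases hn : n = 0
    · simp [hn]
    · have h3 : ∀ᵐ x : ℝ, ∀ m : ℤ,
          ¬ ((x ∈ V ∧ x + n ∈ V) ∧ x ∈ Set.Ico (m : ℝ) (m + 1)) :=
        ae_all_iff.2 fun m ↦ h1 n m hn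
      filter_upwards [(measurePreserving_translation 1 k).quasiMeasurePreserving.ae h3]
        with x hx _ h
      exact hx ⌊x + k * 1⌋ ⟨h, Int.floor_le _, Int.lt_floor_add_one _⟩
  filter_upwards [h2] with x hx k l hk hl
  by_contra hne
  refine hx k (l - k) (sub_ne_zero.2 fun h ↦ hne h.symm) ⟨hk, ?_⟩
  push_cast
  convert hl using 1
  ring

/-- Enlarge V to a tiling D by adding the missing classes from [0, 1). On D the function 1_V - μ(V)
has all Fourier coefficients zero: for k ≠ 0 by hypothesis, for k = 0 because D has measure 1. So
1_V equals the nonzero constant μ(V) on D, and the added part is null. -/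
theorem tilesByTranslation_of_integral (hV : MeasurableSet V) (hfin : volume V ≠ ∞)
    (hpos : volume V ≠ 0)
    (hinj : ∀ᵐ x : ℝ, ∀ k l : ℤ, x + k * 1 ∈ V → x + l * 1 ∈ V → k = l)
    (hintegrable : ∀ k : ℤ, k ≠ 0 → ∫ η in V, expChar k η = 0) : TilesByTranslation 1 V := by
  set S := sat (translationSetoid 1) V with hS
  have hSm : MeasurableSet S := measurableSet_sat_translation 1 hV
  set D := V ∪ (Set.Ico (0 : ℝ) (0 + 1) \ S) with hD
  have hDm : MeasurableSet D := hV.union (measurableSet_Ico.diff hSm)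
  have hSinv : ∀ (x : ℝ) (k : ℤ), x + k * 1 ∈ S → x ∈ S := by
    rintro x k ⟨y, hy, hxy⟩
    exact ⟨y, hy, (translationSetoid 1).trans ⟨k, rfl⟩ hxy⟩
  have hVS : V ⊆ S := fun x hx ↦ ⟨x, hx, (translationSetoid 1).refl x⟩
  have hDt : TilesByTranslation 1 D := by
    filter_upwards [hinj] with x hx
    by_cases hxS : x ∈ S
    · obtain ⟨k, hk⟩ := mem_sat_translation.1 hxS
      refine ⟨k, Or.inl hk, ?_⟩
      rintro l (hl | hl)
      · exact hx l k hl hk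
      · refine absurd ?_ hl.2
        refine hSinv _ (-l) ?_
        simpa using hxS
    · obtain ⟨k, hk⟩ := mem_sat_translation.1 (mem_sat_Ico one_pos 0 x)
      refine ⟨k, Or.inr ⟨hk, fun h ↦ hxS (hSinv x k h)⟩, ?_⟩
      rintro l (hl | hl)
      · exact absurd (hSinv x l (hVS hl)) hxS
      · exact (isPartialSection_Ico_translation one_pos (by simp)).translation_unique one_ne_zero
          hl.1 hk
  have hDfin : volume D ≠ ∞ := by
    refine (measure_union_lt_top hfin.lt_top ?_).ne
    exact lt_of_le_of_lt (measure_mono Set.sdiff_subset) (by simp)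
  set μV : ℂ := ((volume.real V : ℝ) : ℂ) with hμV
  have hμV0 : μV ≠ 0 := by
    rw [hμV, Complex.ofReal_ne_zero, Ne, measureReal_eq_zero_iff hfin]
    exact hpos
  have hintOn : ∀ (k : ℤ) (T : Set ℝ), volume T ≠ ∞ → IntegrableOn (expChar k) T volume := by
    intro k T hT
    refine IntegrableOn.of_bound hT.lt_top
      (continuous_expChar k).aestronglyMeasurable 1 (Eventually.of_forall fun x ↦ ?_)
    rw [norm_expChar]
  have hzero := ae_eq_zero_of_setIntegral_expChar hDt hDm.nullMeasurableSet
    (G := fun x ↦ V.indicator (fun _ ↦ (1 : ℂ)) x - μV) ?_ ?_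
  · rw [ae_restrict_iff' hDm] at hzero
    have h1 : ∀ᵐ x : ℝ, x ∈ Set.Ico (0 : ℝ) (0 + 1) → x ∈ S := by
      filter_upwards [hzero] with x hx hxI
      by_contra hxS
      have h2 := hx (Or.inr ⟨hxI, hxS⟩)
      rw [Set.indicator_of_notMem fun h ↦ hxS (hVS h), zero_sub, neg_eq_zero] at h2
      exact hμV0 h2
    have h2 : ∀ᵐ x : ℝ, ∀ k : ℤ, x + k * 1 ∈ Set.Ico (0 : ℝ) (0 + 1) → x + k * 1 ∈ S :=
      ae_all_iff.2 fun k ↦ (measurePreserving_translation 1 k).quasiMeasurePreserving.ae h1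
    filter_upwards [h2, hinj] with x hx hx'
    obtain ⟨k, hk⟩ := mem_sat_translation.1 (mem_sat_Ico one_pos 0 x)
    obtain ⟨l, hl⟩ := mem_sat_translation.1 (hSinv x k (hx k hk))
    exact ⟨l, hl, fun i hi ↦ hx' i l hi hl⟩
  · refine MemLp.sub ((memLp_indicator_const 2 hV 1 (Or.inr hfin)).restrict D) ?_
    exact memLp_const_iff (by simp) (by simp) |>.2 (Or.inr (by simpa using hDfin.lt_top))
  · intro k
    have hind : ∀ η, expChar k η * (V.indicator (fun _ ↦ (1 : ℂ)) η - μV) =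
        V.indicator (expChar k) η - μV * expChar k η := by
      intro η
      by_cases h : η ∈ V <;> simp [h] <;> ring
    simp only [hind]
    rw [integral_sub ((integrable_indicator_iff hV).2 (hintOn k V hfin)).restrict
      ((hintOn k D hDfin).const_mul μV), setIntegral_indicator hV,
      Set.inter_eq_right.2 (Set.subset_union_left : V ⊆ D), integral_const_mul,
      setIntegral_expChar hDt hDm.nullMeasurableSet]
    by_cases hk : k = 0
    · subst hk
      simp [expChar_zero, hμV]
    · simp [hintegrable k hk, hk]

variable {c : ℂ} {w : Lp ℂ 2 (volume : Measure ℝ)}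

theorem freqAtom_zero_zero (V : Set ℝ) (c : ℂ) : freqAtom V c 0 0 = V.indicator fun _ ↦ c := by
  ext ξ
  simp [freqAtom, expChar_zero]

theorem tiles_of_isOrthonormalWavelet (hV : MeasurableSet V) (hw : IsOrthonormalWavelet w)
    (hwV : (𝓕 w : Lp ℂ 2 (volume : Measure ℝ)) =ᵐ[volume] V.indicator fun _ ↦ c) :
    TilesByTranslation 1 V ∧ TilesByDilation V := by
  obtain ⟨b, hb⟩ := hw
  have hbE : ∀ j k : ℤ, (𝓕 (b (j, k)) : Lp ℂ 2 (volume : Measure ℝ)) =ᵐ[volume]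
      freqAtom V c j k := by
    intro j k
    obtain ⟨g, hg, hg'⟩ := exists_dilated_translate_freqAtom hwV j k
    have : b (j, k) = g := Lp.ext ((hb j k).trans hg.symm)
    rwa [this]
  have hE0 := hbE 0 0
  rw [freqAtom_zero_zero] at hE0
  -- The transform of a unit vector is nonzero. This yields c ≠ 0 and μ(V) ≠ 0, and square
  -- integrability then gives μ(V) < ∞.
  have hne : ¬ (V.indicator fun _ ↦ c) =ᵐ[volume] (0 : ℝ → ℂ) := by
    intro h
    have h1 : (𝓕 (b (0, 0)) : Lp ℂ 2 (volume : Measure ℝ)) = 0 :=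
      Lp.ext ((hE0.trans h).trans (Lp.coeFn_zero ℂ 2 (volume : Measure ℝ)).symm)
    have h2 := Lp.norm_fourier_eq (b (0, 0))
    rw [h1, b.orthonormal.1 (0, 0), norm_zero] at h2
    exact zero_ne_one h2
  have hc : c ≠ 0 := by
    rintro rfl
    exact hne (by simp only [Set.indicator_zero]; rfl)
  have hpos : volume V ≠ 0 := by
    intro h
    refine hne ?_
    filter_upwards [measure_eq_zero_iff_ae_notMem.1 h] with x hx
    rw [Set.indicator_of_notMem hx, Pi.zero_apply]
  have hfin : volume V ≠ ∞ := by
    have h1 : MemLp (V.indicator fun _ ↦ c) 2 volume := (memLp_congr_ae hwV).1 (Lp.memLp _)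
    rw [memLp_indicator_iff_restrict hV, memLp_const_iff (by simp) (by simp)] at h1
    simpa using (h1.resolve_left hc).ne
  have hsqrt : ∀ j : ℤ, ((√((2 : ℝ) ^ j) : ℝ) : ℂ) ≠ 0 := fun j ↦
    Complex.ofReal_ne_zero.2 (Real.sqrt_pos.2 (zpow_pos two_pos _)).ne'
  have hinner : ∀ (j k : ℤ) (f : Lp ℂ 2 (volume : Measure ℝ)), inner ℂ (b (j, k)) f = 0 ↔
      ∫ η in V, expChar k η * (𝓕 f : Lp ℂ 2 (volume : Measure ℝ)) ((2 : ℝ) ^ j * η) = 0 := by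
    intro j k f
    rw [← Lp.inner_fourier_eq, inner_freqAtom hV (hbE j k)]
    simp [hsqrt j, hc]
  have horth : ∀ j k : ℤ, (j, k) ≠ (0, 0) →
      ∫ η in V, expChar k η * V.indicator (fun _ ↦ (1 : ℂ)) ((2 : ℝ) ^ j * η) = 0 := by
    intro j k hjk
    have h1 := (hinner j k (b (0, 0))).1 (b.orthonormal.2 hjk)
    have h2 : ∫ η in V, expChar k η *
        (𝓕 (b (0, 0)) : Lp ℂ 2 (volume : Measure ℝ)) ((2 : ℝ) ^ j * η) =
        ∫ η in V, c * (expChar k η * V.indicator (fun _ ↦ (1 : ℂ)) ((2 : ℝ) ^ j * η)) := by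
      refine integral_congr_ae (ae_restrict_of_ae ?_)
      filter_upwards [(quasiMeasurePreserving_dilation j).ae hE0] with η hη
      rw [hη]
      by_cases h : (2 : ℝ) ^ j * η ∈ V
      · simp only [Set.indicator_of_mem h]
        ring
      · simp only [Set.indicator_of_notMem h, mul_zero]
    rw [h2, integral_const_mul] at h1
    exact (mul_eq_zero.1 h1).resolve_left hc
  -- Completeness of the basis is moved to the Fourier side by testing against the inverse transform
  -- of F.
  have hcomp : ∀ F : ℝ → ℂ, MemLp F 2 volume →
      (∀ j k : ℤ, ∫ η in V, expChar k η * F ((2 : ℝ) ^ j * η) = 0) → F =ᵐ[volume] 0 := by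
    intro F hF h0
    set f : Lp ℂ 2 (volume : Measure ℝ) := 𝓕⁻ (hF.toLp F) with hf
    have hFf : 𝓕 f = hF.toLp F := FourierTransform.fourier_fourierInv_eq _
    have h1 : ∀ i, inner ℂ (b i) f = 0 := by
      rintro ⟨j, k⟩
      rw [hinner, hFf, ← h0 j k]
      refine integral_congr_ae (ae_restrict_of_ae ?_)
      filter_upwards [(quasiMeasurePreserving_dilation j).ae hF.coeFn_toLp] with η hη
      rw [hη]
    have h2 : f = 0 := by
      have := b.hasSum_repr f
      simp only [b.repr_apply_apply, h1, zero_smul] at this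
      exact this.unique hasSum_zero
    have h3 : hF.toLp F = 0 := by
      rw [← hFf, h2]
      exact map_zero (Lp.fourierTransformₗᵢ ℝ ℂ)
    exact hF.coeFn_toLp.symm.trans (h3 ▸ Lp.coeFn_zero ℂ 2 (volume : Measure ℝ))
  have hd : TilesByDilation V := by
    refine tilesByDilation_of_complete hV hfin (fun j hj ↦ ?_) hcomp
    simpa [expChar_zero] using horth j 0 (by simp [hj])
  refine ⟨?_, hd⟩
  refine tilesByTranslation_of_integral hV hfin hpos
    (ae_translation_unique_of_complete hV hd hcomp) fun k hk ↦ ?_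
  rw [← horth 0 k (by simp [hk])]
  refine setIntegral_congr_fun hV fun η hη ↦ ?_
  simp [hη]

end Necessity

/-! ### Wavelet sets are the sets tiling by translations and dilations -/

section Scaling

variable {p : ℝ} {W : Set ℝ}

theorem tilesByTranslation_preimage_mul_iff (hp : 0 < p) :
    TilesByTranslation 1 ((fun x ↦ p * x) ⁻¹' W) ↔ TilesByTranslation p W := by
  constructor
  · intro h
    filter_upwards [(quasiMeasurePreserving_mul (inv_ne_zero hp.ne')).ae h] with x hx
    have h1 : ∀ k : ℤ, p * (p⁻¹ * x + k * 1) = x + k * p := fun k ↦ by field_simp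
    simpa only [Set.mem_preimage, h1] using hx
  · intro h
    filter_upwards [(quasiMeasurePreserving_mul hp.ne').ae h] with x hx
    have h1 : ∀ k : ℤ, p * (x + k * 1) = p * x + k * p := fun k ↦ by ring
    simpa only [Set.mem_preimage, h1] using hx

theorem tilesByDilation_preimage_mul_iff (hp : 0 < p) :
    TilesByDilation ((fun x ↦ p * x) ⁻¹' W) ↔ TilesByDilation W := by
  constructor
  · intro h
    filter_upwards [(quasiMeasurePreserving_mul (inv_ne_zero hp.ne')).ae h] with x hx
    have h1 : ∀ j : ℤ, p * ((2 : ℝ) ^ j * (p⁻¹ * x)) = (2 : ℝ) ^ j * x := fun j ↦ by field_simp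
    simpa only [Set.mem_preimage, h1] using hx
  · intro h
    filter_upwards [(quasiMeasurePreserving_mul hp.ne').ae h] with x hx
    have h1 : ∀ j : ℤ, p * ((2 : ℝ) ^ j * x) = (2 : ℝ) ^ j * (p * x) := fun j ↦ by ring
    simpa only [Set.mem_preimage, h1] using hx

theorem TilesByTranslation.volume_real_eq (hp : 0 < p) (hW : TilesByTranslation p W)
    (hm : NullMeasurableSet W) : volume.real W = p := by
  have h : TilesByTranslation p (Set.Ico 0 (0 + p)) :=
    tilesByTranslation_of_section hp.ne' (isPartialSection_Ico_translation hp (by simp))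
      (mem_sat_Ico hp 0)
  rw [measureReal_def, hW.volume_eq h hm measurableSet_Ico.nullMeasurableSet, Real.volume_Ico]
  simp [hp.le]

end Scaling

theorem indicator_ae_eq_of_ae_eq {S T : Set ℝ} (h : S =ᵐ[volume] T) (c : ℂ) :
    (S.indicator fun _ ↦ c) =ᵐ[volume] T.indicator fun _ ↦ c :=
  indicator_ae_eq_of_ae_eq_set h

/-- A set is a wavelet set if and only if it tiles the line both by translations by multiples of
`2π` and by dilations by powers of `2`. -/
theorem isWaveletSet_iff {W : Set ℝ} :
    IsWaveletSet W ↔ NullMeasurableSet W ∧ TilesByTranslation (2 * Real.pi) W ∧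
      TilesByDilation W := by
  have hp : 0 < 2 * Real.pi := Real.two_pi_pos
  have hsq : ((√(2 * Real.pi) : ℝ) : ℂ) ≠ 0 :=
    Complex.ofReal_ne_zero.2 (Real.sqrt_pos.2 hp).ne'
  constructor
  · rintro ⟨hm, w, hw, hwW⟩
    refine ⟨hm, ?_⟩
    obtain ⟨W', -, hW'm, hW'⟩ := hm.exists_measurable_subset_ae_eq
    set c : ℂ := (((√(volume.real W))⁻¹ : ℝ) : ℂ)
    have hV : MeasurableSet ((fun x ↦ 2 * Real.pi * x) ⁻¹' W') := (measurable_const_mul _) hW'm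
    have hwV : (𝓕 w : Lp ℂ 2 (volume : Measure ℝ)) =ᵐ[volume]
        ((fun x ↦ 2 * Real.pi * x) ⁻¹' W').indicator
          fun _ ↦ ((√(2 * Real.pi) : ℝ) : ℂ) * c := by
      filter_upwards [(quasiMeasurePreserving_mul hp.ne').ae
        (hwW.trans (indicator_ae_eq_of_ae_eq hW' c).symm)] with ξ hξ
      rw [fourierPlancherel, mul_div_cancel_left₀ ξ hp.ne', Complex.ofReal_inv,
        inv_mul_eq_iff_eq_mul₀ hsq] at hξ
      rw [hξ]
      by_cases h : 2 * Real.pi * ξ ∈ W'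
      · rw [Set.indicator_of_mem h, Set.indicator_of_mem (by exact h)]
      · rw [Set.indicator_of_notMem h, Set.indicator_of_notMem (by exact h), mul_zero]
    obtain ⟨ht, hd⟩ := tiles_of_isOrthonormalWavelet hV hw hwV
    exact ⟨((tilesByTranslation_preimage_mul_iff hp).1 ht).congr hW',
      ((tilesByDilation_preimage_mul_iff hp).1 hd).congr hW'⟩
  · rintro ⟨hm, ht, hd⟩
    refine ⟨hm, ?_⟩
    obtain ⟨W', -, hW'm, hW'⟩ := hm.exists_measurable_subset_ae_eq
    set V : Set ℝ := (fun x ↦ 2 * Real.pi * x) ⁻¹' W'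
    have hV : MeasurableSet V := (measurable_const_mul _) hW'm
    have htV : TilesByTranslation 1 V :=
      (tilesByTranslation_preimage_mul_iff hp).2 (ht.congr hW'.symm)
    have hdV : TilesByDilation V := (tilesByDilation_preimage_mul_iff hp).2 (hd.congr hW'.symm)
    have hVfin : volume V ≠ ∞ := by
      intro h
      have := htV.volume_real_eq one_pos hV.nullMeasurableSet
      rw [measureReal_def, h] at this
      simp at this
    set w : Lp ℂ 2 (volume : Measure ℝ) := 𝓕⁻ (indicatorConstLp 2 hV hVfin (1 : ℂ)) with hw
    have hFw : 𝓕 w = indicatorConstLp 2 hV hVfin (1 : ℂ) :=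
      FourierTransform.fourier_fourierInv_eq _
    have hwV : (𝓕 w : Lp ℂ 2 (volume : Measure ℝ)) =ᵐ[volume] V.indicator fun _ ↦ (1 : ℂ) := by
      rw [hFw]
      exact indicatorConstLp_coeFn
    refine ⟨w, isOrthonormalWavelet_of_tiles hV htV hdV hwV, ?_⟩
    -- A tile for translations by 2π has measure 2π, so μ(W)^{-1/2} is exactly the factor in
    -- `fourierPlancherel`, and `𝓕 w` needs height 1 on V.
    rw [ht.volume_real_eq hp hm]
    refine EventuallyEq.trans ?_ (indicator_ae_eq_of_ae_eq hW' _)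
    filter_upwards [(quasiMeasurePreserving_mul (inv_ne_zero hp.ne')).ae hwV] with x hx
    rw [fourierPlancherel, div_eq_inv_mul, hx]
    have hmem : (2 * Real.pi)⁻¹ * x ∈ V ↔ x ∈ W' := by
      rw [Set.mem_preimage, mul_inv_cancel_left₀ hp.ne']
    by_cases h : x ∈ W'
    · rw [Set.indicator_of_mem h, Set.indicator_of_mem (hmem.2 h), mul_one]
    · rw [Set.indicator_of_notMem h, Set.indicator_of_notMem fun h' ↦ h (hmem.1 h'), mul_zero]

end WaveletSet

end

theorem theorem3p5 (W₀ W₁ : Set ℝ) (h₀ : IsWaveletSet W₀) (h₁ : IsWaveletSet W₁) :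
    ∃ W : unitInterval → Set ℝ,
      W 0 = W₀ ∧ W 1 = W₁ ∧ (∀ t, IsWaveletSet (W t)) ∧
        ∀ s, Tendsto (fun t ↦ waveletSetDist (W t) (W s)) (𝓝 s) (𝓝 0) := by
  simp only [WaveletSet.isWaveletSet_iff] at h₀ h₁ ⊢
  exact WaveletSet.exists_path_of_tiles Real.two_pi_pos h₀.1 h₀.2.1 h₀.2.2 h₁.1 h₁.2.1 h₁.2.2
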